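/- Let $n\ge 5$. For a finite word $u$, $|u|$ is its length and $\mathrm{per}(u)$ its least positive period. Let $\mathbf T_m$ be the set of threshold words over an $m$-letter alphabet $\mathbf A_m$: the finite words all of whose nonempty factors $u$ satisfy $|u|/\mathrm{per}(u)\le m/(m-1)$. Let $\mathbf D^{\varepsilon}_{3,n}$ be the set of words over $\mathbf A_n$ all of whose factors $u$ with $\mathrm{per}(u)\ge 3n-3$ satisfy $(|u|+\varepsilon)/\mathrm{per}(u)\le n/(n-1)$. Let $V$ be a finite set of words of length $L$ over $\mathbf A_n$; let $l(V)$ and $r(V)$ be the greatest lengths of a common prefix, respectively common suffix, of two different words of $V$, and in part (A) put $\varepsilon=(l(V)+r(V))/(L-1)$. In both parts some words of $V$ are assigned as images to letters; one assigned word $v$ (an image of a letter $b$) is called replaceable, and one word $v'\in V$ that is not assigned is its alternative. For a letter $a$ let $V_a$ be the set of images of $a$, where $v'$ is also counted in $V_b$. For a real $\delta$ let $\mathrm{(C)}_\delta$ be the condition: for every letter $a$, all $x,x'\in V_a$ and all different $u,w\in V\setminus V_a$, if $u$ and $x$ have a common prefix of length $l$, and $x'$ and $w$ have a common suffix of length $r$,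 then $\delta+l+r\le L/(n-1)$. (A) Suppose $|V|\ge 3n+1$, $L\ge 6(n-1)$, $\mathrm{per}(u)=L$ for all $u\in V$, $uw\in\mathbf D^{\varepsilon}_{3,n}\cap\mathbf T_n$ for all different $u,w\in V$; each letter $a\in\mathbf A_n$ has three images $v_{a,1},v_{a,2},v_{a,3}\in V$, all $3n$ of them different; and $\mathrm{(C)}_\varepsilon$ holds. Let $f$ be the substitution that replaces the $j$-th occurrence of each letter $a$ in a word by $v_{a,i}$ with $i\in\{1,2,3\}$, $i\equiv j \pmod 3$. Then for every word $w\in\mathbf D^{\varepsilon}_{3,n}\cap\mathbf T_n$, replacing $v$ by $v'$ in $f(w)$ at the letters of $w$ in any subset of those whose image is $v$ gives a word of $\mathbf D^{\varepsilon}_{3,n}\cap\mathbf T_n$. (B) Suppose $k\ge 1$, $|V|\ge n+k+1$, $\mathrm{per}(u)=L$ for all $u\in V$, $uw\in\mathbf T_n$ for all different $u,w\in V$; $l+r\le L/(n-1)$ whenever $x,y,z\in V$ are pairwise different, $x,y$ have a common suffix of length $l$ and $y,z$ have a common prefix of length $r$; each letter of $\mathbf A_{n+k}$ has one image in $V$,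 different letters having different images; and $\mathrm{(C)}_0$ holds. Let $f$ be the corresponding morphism. Then for every $w\in\mathbf T_{n+k}$, replacing $v$ by $v'$ in $f(w)$ at the letters of $w$ in any subset of those whose image is $v$ gives a word of $\mathbf T_n$. Moreover, let $\omega$ be a right-infinite word all of whose finite prefixes belong to $\mathbf D^{\varepsilon}_{3,n}\cap\mathbf T_n$ in case (A), to $\mathbf T_{n+k}$ in case (B). Let $\mathcal T$ be the tree whose vertices are all prefixes of the words obtained from $f(p)$, $p$ a finite prefix of $\omega$, by all such replacements, ordered by the prefix relation. Then all vertices of $\mathcal T$ belong to $\mathbf D^{\varepsilon}_{3,n}\cap\mathbf T_n$, respectively to $\mathbf T_n$. Put $(c,C)=((3n-3)L,(3n+3)L)$ in case (A) and $(c,C)=((n+k-1)L,(n+k+1)L)$ in case (B). Call a vertex of $\mathcal T$ branching if it has at least two one-letter extensions in $\mathcal T$, and call branching vertices $x\ne y$ neighbouring if $x$ is a prefix of $y$ and no other branching vertex lies between them. Then every vertex $x$ is a prefix of a branching vertex $y$ with $|y|<|x|+C$; neighbouring branching vertices satisfy $c\le |y|-|x|\le C$; and for every $m$ the tree has at least $2^{\lfloor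 m/C\rfloor}$ vertices of length $m$ (exponential growth). -/

import Mathlib

namespace ThresholdWords

/-- The period `per(w)`: the least positive period of `w`. -/
noncomputable def per {α : Type*} (w : List α) : ℕ :=
  sInf {p : ℕ | 0 < p ∧ w.HasPeriod p}

/-- The threshold words over `n` letters: every nonempty factor has exponent
`|u| / per(u)` at most `n / (n - 1)`. -/
def threshold (n : ℕ) : Set (List (Fin n)) :=
  {w | ∀ u : List (Fin n), u <:+: w → u ≠ [] →
    (u.length : ℝ) / (per u : ℝ) ≤ (n : ℝ) / ((n : ℝ) - 1)}

/-- The words over `n` letters all of whose nonempty factors `u` with `per(u) ∈ P` satisfy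
`(|u| + ε) / per(u) ≤ n / (n - 1)`. -/
def epsBounded (n : ℕ) (ε : ℝ) (P : Set ℕ) : Set (List (Fin n)) :=
  {w | ∀ u : List (Fin n), u <:+: w → u ≠ [] → per u ∈ P →
    ((u.length : ℝ) + ε) / (per u : ℝ) ≤ (n : ℝ) / ((n : ℝ) - 1)}

/-- `D^ε_{3,n} ∩ T_n`, where `D^ε_{3,n}` constrains the factors of period at least `3n - 3`. -/
def epsThreshold (n : ℕ) (ε : ℝ) : Set (List (Fin n)) :=
  epsBounded n ε {p : ℕ | 3 * (n - 1) ≤ p} ∩ threshold n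

/-- `l(V)`: the greatest length of a common prefix of two different words of `V`. -/
noncomputable def maxCommonPrefix {α : Type*} (V : Finset (List α)) : ℕ :=
  sSup {m : ℕ | ∃ u ∈ V, ∃ v ∈ V, u ≠ v ∧ ∃ x : List α, x <+: u ∧ x <+: v ∧ x.length = m}

/-- `r(V)`: the greatest length of a common suffix of two different words of `V`. -/
noncomputable def maxCommonSuffix {α : Type*} (V : Finset (List α)) : ℕ :=
  sSup {m : ℕ | ∃ u ∈ V, ∃ v ∈ V, u ≠ v ∧ ∃ x : List α, x <:+ u ∧ x <:+ v ∧ x.length = m}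

/-- `ε = (l(V) + r(V)) / (L - 1)`. -/
noncomputable def eps {α : Type*} (V : Finset (List α)) (L : ℕ) : ℝ :=
  ((maxCommonPrefix V : ℝ) + (maxCommonSuffix V : ℝ)) / ((L : ℝ) - 1)

/-- The images of the letter `a` once the image `v` may be replaced by `v'`: the original images
`I a`, together with `v'` if `v` is one of them. -/
def imagesWith {α β : Type*} (I : α → Set (List β)) (v v' : List β) (a : α) : Set (List β) :=
  {x | x ∈ I a ∨ (x = v' ∧ v ∈ I a)}

/-- For every letter `a` with image set `J a`, all `x, x' ∈ J a` and all different `u, w ∈ V`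
outside `J a`: a common prefix of `u` and `x` and a common suffix of `x'` and `w` have
lengths `l`, `r` with `ε + l + r ≤ L / (n - 1)`. -/
def OverlapCondition {α : Type*} (n L : ℕ) (ε : ℝ) (V : Finset (List (Fin n)))
    (J : α → Set (List (Fin n))) : Prop :=
  ∀ a : α, ∀ u ∈ V, u ∉ J a → ∀ w ∈ V, w ∉ J a → u ≠ w → ∀ x ∈ J a, ∀ x' ∈ J a,
    ∀ p s : List (Fin n), p <+: u → p <+: x → s <:+ x' → s <:+ w →
      ε + ((p.length : ℝ) + (s.length : ℝ)) ≤ (L : ℝ) / ((n : ℝ) - 1)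

/-- The conditions of the three-valued (context-dependent) substitution on a set `V` of words
of length `L`, where `J a` is the set of images of the letter `a`. -/
structure CyclicConditions (n L : ℕ) (V : Finset (List (Fin n)))
    (J : Fin n → Set (List (Fin n))) : Prop where
  length_ge : 6 * (n - 1) ≤ L
  length_eq : ∀ v ∈ V, v.length = L
  per_eq : ∀ v ∈ V, per v = v.length
  pair : ∀ u ∈ V, ∀ v ∈ V, u ≠ v → u ++ v ∈ epsThreshold n (eps V L)
  overlap : OverlapCondition n L (eps V L) V J

/-- The conditions of the uniform morphism on a set `V` of words of length `L`. -/
structure MorphismConditions (n L : ℕ) (V : Finset (List (Fin n))) : Prop where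
  length_eq : ∀ v ∈ V, v.length = L
  per_eq : ∀ v ∈ V, per v = v.length
  pair : ∀ u ∈ V, ∀ v ∈ V, u ≠ v → u ++ v ∈ threshold n
  triple : ∀ u ∈ V, ∀ v ∈ V, ∀ w ∈ V, u ≠ v → v ≠ w → u ≠ w →
    ∀ s p : List (Fin n), s <:+ u → s <:+ v → p <+: v → p <+: w →
      (s.length : ℝ) + (p.length : ℝ) ≤ (L : ℝ) / ((n : ℝ) - 1)

/-- Context-dependent substitution: `F u a` is the image of a letter `a` preceded by the word `u`;
`substFrom F u w` is the image of `w` when `w` is preceded by `u`. -/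
def substFrom {α β : Type*} (F : List α → α → List β) : List α → List α → List β
  | _, [] => []
  | u, a :: w => F u a ++ substFrom F (u ++ [a]) w

/-- The image of the word `w`. -/
def subst {α β : Type*} (F : List α → α → List β) (w : List α) : List β :=
  substFrom F [] w

/-- The three images of each letter are used in cyclic order along the occurrences of the letter. -/
def cyclicRule {α β : Type*} [DecidableEq α] (im : α → Fin 3 → List β) (u : List α) (a : α) :
    List β :=
  im a ⟨u.count a % 3, Nat.mod_lt _ (by norm_num)⟩

/-- The rule of an ordinary morphism `f`. -/
def morphismRule {α β : Type*} (f : α → List β) (_u : List α) (a : α) : List β :=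
  f a

open Classical in
/-- The rule `F` with the image `v` replaced by `v'` at those of its occurrences whose position
in the preimage belongs to `S`. -/
noncomputable def replaceRule {α β : Type*} (F : List α → α → List β) (v v' : List β)
    (S : Set ℕ) (u : List α) (a : α) : List β :=
  if F u a = v ∧ u.length ∈ S then v' else F u a

/-- The prefix of length `m` of the infinite word `ω`. -/
def initialWord {α : Type*} (ω : ℕ → α) (m : ℕ) : List α :=
  (List.range m).map ω

/-- The tree of all words obtained from the infinite word `ω` by replacing `v` by `v'` at arbitrary
sets of occurrences: its vertices are the prefixes of the images, ordered by extension. -/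
def replacementTree {α β : Type*} (F : List α → α → List β) (v v' : List β) (ω : ℕ → α) :
    Set (List β) :=
  {x | ∃ (S : Set ℕ) (m : ℕ), x <+: subst (replaceRule F v v' S) (initialWord ω m)}

/-- A branching vertex of a tree of words: a vertex with at least two children. -/
def IsBranching {β : Type*} (T : Set (List β)) (x : List β) : Prop :=
  ∃ c d : β, c ≠ d ∧ x ++ [c] ∈ T ∧ x ++ [d] ∈ T

/-- `y` is the next branching vertex above the branching vertex `x` on some branch. -/
def AreNeighbours {β : Type*} (T : Set (List β)) (x y : List β) : Prop :=
  IsBranching T x ∧ IsBranching T y ∧ x <+: y ∧ x ≠ y ∧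
    ∀ z : List β, IsBranching T z → x <+: z → z <+: y → z = x ∨ z = y

/-- Every vertex has a branching vertex less than `hi` letters above it, neighbouring branching
vertices are at distance at least `lo` and at most `hi`, and the tree grows exponentially:
there are at least `2 ^ ⌊m / hi⌋` vertices of depth `m`. -/
structure UniformlyGrowing {β : Type*} (T : Set (List β)) (lo hi : ℕ) : Prop where
  branches : ∀ x ∈ T, ∃ y : List β, IsBranching T y ∧ x <+: y ∧ y.length < x.length + hi
  distance : ∀ x y : List β, AreNeighbours T x y →
    x.length + lo ≤ y.length ∧ y.length ≤ x.length + hi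
  growth : ∀ m : ℕ, 2 ^ (m / hi) ≤ {x : List β | x ∈ T ∧ x.length = m}.ncard

end ThresholdWords

/-! Both sets of words are described by repetitions: a factor of length `p + q` with period `p`, not
necessarily the least one, has repeated part of length `q`, and membership means that `Admissible`
holds for all of them (`mem_threshold_iff`, `mem_epsThreshold_iff`). Case (B) uses the same
machinery as case (A), with `ε = 0`.

The image of a word is a product of blocks of length `L` from `V`, neighbouring ones being
different. If `L` does not divide the period, the two occurrences of the repeated part start at
different offsets in their blocks. Blocks have no nontrivial overlaps, so the occurrence with the
smaller offset stays inside one block, and the condition on products of two different words suffices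
(`admissible_of_not_dvd`). If the period is `k * L`, the repeated part is covered by a common suffix
of two different blocks, some number `d` of complete equal blocks, and a common prefix of two
different blocks (`alignedRep`). For `d = 0` the pair condition and the overlap condition suffice
(`admissible_or_alignedRep`).

For `d ≥ 1` the repetition descends to the preimage, with period `k` and repeated part `d`, because
`v'` can only come from `v`. In (A) equal blocks also have equal occurrence counts modulo 3, so `k ≥
3 * (n - 1)` and the preimage satisfies the bound with `ε`; the value of `ε` is the one for which
this bound carries over to the image. In (B) the larger alphabet leaves room for the suffix and the
prefix unless one letter returns at distance `n` over `n + 1` letters; there the outer neighbours of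
the two occurrences coincide and the overlap condition applies (`letter_eq_of_return`).

For the tree, the images of `ω` form a family of infinite words with independent binary choices at
the blocks equal to `v`. Branching happens exactly at the first difference of `v` and `v'` in such
blocks, so distances and growth follow from how often these blocks recur. -/

namespace ThresholdWords

/-! ### Repetitions instead of exponents -/

/-- A repetition of period `p` in `w`: the factors of length `q` at `i` and at `i + p` agree. -/
def IsRep {α : Type*} (w : List α) (i p q : ℕ) : Prop :=
  i + p + q ≤ w.length ∧ ∀ t < q, w[i + t]? = w[i + p + t]?

/-- The bound which `epsThreshold n ε` imposes on a repetition of period `p` whose repeated part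
has length `q`. -/
def Admissible (n : ℕ) (ε : ℝ) (p q : ℕ) : Prop :=
  ((n : ℝ) - 1) * q ≤ p ∧ (3 * (n - 1) ≤ p → ((n : ℝ) - 1) * (q + ε) ≤ p)

theorem per_spec {α : Type*} {u : List α} (hu : u ≠ []) :
    0 < per u ∧ u.HasPeriod (per u) := by
  have h : (u.length) ∈ {p : ℕ | 0 < p ∧ u.HasPeriod p} :=
    ⟨List.length_pos_iff.2 hu, List.hasPeriod_of_length_le _ _ le_rfl⟩
  exact Nat.sInf_mem ⟨_, h⟩

theorem per_le {α : Type*} {u : List α} {p : ℕ} (hp : 0 < p) (h : u.HasPeriod p) : per u ≤ p :=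
  Nat.sInf_le ⟨hp, h⟩

theorem div_le_iff_mul_sub {n : ℕ} (hn : 2 ≤ n) {p : ℕ} (hp : 0 < p) (x : ℝ) :
    x / (p : ℝ) ≤ (n : ℝ) / ((n : ℝ) - 1) ↔ ((n : ℝ) - 1) * (x - p) ≤ p := by
  have h1 : (0 : ℝ) < (n : ℝ) - 1 := by
    have : (2 : ℝ) ≤ n := by exact_mod_cast hn
    linarith
  have h2 : (0 : ℝ) < p := by exact_mod_cast hp
  rw [div_le_div_iff₀ h2 h1]
  constructor <;> intro h <;> linarith

theorem infix_iff_getElem? {α : Type*} {u w : List α} :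
    u <:+: w ↔ ∃ i, i + u.length ≤ w.length ∧ ∀ t < u.length, u[t]? = w[i + t]? := by
  constructor
  · rintro ⟨s, r, rfl⟩
    refine ⟨s.length, by simp, fun t ht => ?_⟩
    rw [List.append_assoc, List.getElem?_append_right (by omega), List.getElem?_append_left (by omega)]
    congr 1; omega
  · rintro ⟨i, hi, h⟩
    have : u = (w.drop i).take u.length := by
      apply List.ext_getElem?
      intro t
      rw [List.getElem?_take]
      split_ifs with ht
      · rw [h t ht, List.getElem?_drop]
      · exact List.getElem?_eq_none (by omega)
    rw [this]
    exact (List.take_prefix _ _).isInfix.trans (List.drop_suffix _ _).isInfix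

theorem isRep_of_infix {α : Type*} {u w : List α} (h : u <:+: w) (hu : u ≠ []) :
    ∃ i, IsRep w i (per u) (u.length - per u) ∧ per u ≤ u.length := by
  obtain ⟨i, hi, hw⟩ := infix_iff_getElem?.1 h
  obtain ⟨h0, hp⟩ := per_spec hu
  have hle : per u ≤ u.length :=
    per_le (List.length_pos_iff.2 hu) (List.hasPeriod_of_length_le _ _ le_rfl)
  refine ⟨i, ⟨by omega, fun t ht => ?_⟩, hle⟩
  rw [← hw t (by omega), List.hasPeriod_iff_getElem?.1 hp t ht, hw _ (by omega)]
  congr 1; omega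

theorem infix_of_isRep {α : Type*} {w : List α} {i p q : ℕ} (h : IsRep w i p q) :
    ∃ u : List α, u <:+: w ∧ u.length = p + q ∧ u.HasPeriod p ∧
      ∀ t < p + q, u[t]? = w[i + t]? := by
  obtain ⟨h1, h2⟩ := h
  have hlen : ((w.drop i).take (p + q)).length = p + q := by simp; omega
  have hget : ∀ t < p + q, ((w.drop i).take (p + q))[t]? = w[i + t]? := fun t ht => by
    rw [List.getElem?_take, if_pos ht, List.getElem?_drop]
  refine ⟨(w.drop i).take (p + q),
    (List.take_prefix _ _).isInfix.trans (List.drop_suffix _ _).isInfix, hlen, ?_, hget⟩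
  rw [List.hasPeriod_iff_getElem?]
  intro t ht
  rw [hget _ (by omega), hget _ (by omega), h2 t (by omega)]
  congr 1; omega

theorem mem_threshold_iff {n : ℕ} (hn : 2 ≤ n) {w : List (Fin n)} :
    w ∈ threshold n ↔ ∀ i p q, 1 ≤ p → IsRep w i p q → ((n : ℝ) - 1) * q ≤ p := by
  have h1 : (0 : ℝ) < (n : ℝ) - 1 := by
    have : (2 : ℝ) ≤ n := by exact_mod_cast hn
    linarith
  constructor
  · intro h i p q hp hr
    obtain ⟨u, hu, hlen, hper, -⟩ := infix_of_isRep hr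
    have hne : u ≠ [] := by rintro rfl; simp at hlen; omega
    have := h u hu hne
    rw [div_le_iff_mul_sub hn (per_spec hne).1, hlen] at this
    have hle : (per u : ℝ) ≤ p := by exact_mod_cast per_le hp hper
    push_cast at this
    nlinarith
  · intro h u hu hne
    obtain ⟨i, hr, hle⟩ := isRep_of_infix hu hne
    have := h i _ _ (per_spec hne).1 hr
    rw [div_le_iff_mul_sub hn (per_spec hne).1]
    rwa [Nat.cast_sub hle] at this

/-- The definition only constrains least periods. The point is that a period `p ≥ 3 * (n - 1)` of a
factor with nonempty repeated part cannot hide a least period below `3 * (n - 1)`. -/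
theorem mem_epsThreshold_iff {n : ℕ} (hn : 3 ≤ n) {ε : ℝ} (hε : ε ≤ 1)
    {w : List (Fin n)} :
    w ∈ epsThreshold n ε ↔ ∀ i p q, 1 ≤ p → IsRep w i p q → Admissible n ε p q := by
  have h1 : (2 : ℝ) ≤ (n : ℝ) - 1 := by
    have : (3 : ℝ) ≤ n := by exact_mod_cast hn
    linarith
  constructor
  · rintro ⟨hE, hT⟩ i p q hp hr
    rw [mem_threshold_iff (by omega)] at hT
    refine ⟨hT i p q hp hr, fun h3 => ?_⟩
    have hpr : (3 : ℝ) * ((n : ℝ) - 1) ≤ p := by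
      have : ((3 * (n - 1) : ℕ) : ℝ) ≤ p := by exact_mod_cast h3
      rw [Nat.cast_mul, Nat.cast_sub (by omega)] at this
      exact_mod_cast this
    rcases Nat.eq_zero_or_pos q with rfl | hq
    · push_cast; nlinarith
    obtain ⟨u, hu, hlen, hper, hget⟩ := infix_of_isRep hr
    have hne : u ≠ [] := by rintro rfl; simp at hlen; omega
    have hle := per_le hp hper
    obtain ⟨hp0, hp1⟩ := per_spec hne
    by_cases h4 : 3 * (n - 1) ≤ per u
    · have := hE u hu hne h4
      rw [div_le_iff_mul_sub (by omega) hp0, hlen] at this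
      have hle : (per u : ℝ) ≤ p := by exact_mod_cast hle
      push_cast at this
      nlinarith
    -- The threshold bound leaves at most two letters beyond the least period, while `per u < p` and
    -- `q ≥ 1`. Hence `q = 1` and `p = per u + 1`, and the two periods together force two adjacent
    -- equal letters.
    · exfalso
      obtain ⟨j, hr', hle'⟩ := isRep_of_infix hu hne
      have hb := hT j _ _ hp0 hr'
      have hb' : (n - 1) * (u.length - per u) ≤ per u := by
        rw [← Nat.cast_le (α := ℝ), Nat.cast_mul, Nat.cast_sub (by omega : 1 ≤ n)]
        exact_mod_cast hb
      have hlt : u.length - per u < 3 := by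
        by_contra h5
        have := Nat.mul_le_mul_left (n - 1) (not_lt.1 h5)
        omega
      have e1 : u[0]? = u[p]? := by
        simpa using List.hasPeriod_iff_getElem?.1 hper 0 (by omega)
      have e2 : u[1]? = u[1 + per u]? := List.hasPeriod_iff_getElem?.1 hp1 1 (by omega)
      have e3 : 1 + per u = p := by omega
      rw [e3, ← e1, hget _ (by omega), hget _ (by omega)] at e2
      have := hT i 1 1 le_rfl ⟨by have := hr.1; omega, fun t ht => by
        obtain rfl : t = 0 := by omega
        simpa using e2.symm⟩
      push_cast at this
      linarith
  · intro h
    refine ⟨fun u hu hne hP => ?_, (mem_threshold_iff (by omega)).2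
      fun i p q hp hr => (h i p q hp hr).1⟩
    obtain ⟨i, hr, hle⟩ := isRep_of_infix hu hne
    have := (h i _ _ (per_spec hne).1 hr).2 hP
    rw [div_le_iff_mul_sub (by omega) (per_spec hne).1]
    rw [Nat.cast_sub hle] at this
    linarith

/-- This makes the morphism case an instance of the arguments with `ε`. -/
theorem epsThreshold_zero (n : ℕ) : epsThreshold n 0 = threshold n := by
  refine Set.inter_eq_right.2 fun w hw u hu hne _ => ?_
  simpa using hw u hu hne

theorem epsThreshold_of_infix {n : ℕ} {ε : ℝ} {u w : List (Fin n)} (h : u <:+: w)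
    (hw : w ∈ epsThreshold n ε) : u ∈ epsThreshold n ε :=
  ⟨fun x hx => hw.1 x (hx.trans h), fun x hx => hw.2 x (hx.trans h)⟩



/-! ### Block codes, and periods that are not multiples of the block length -/

/-- A set `V` of unbordered words of length `L` such that the product of two different words
of `V` lies in `epsThreshold n ε`. -/
structure IsBlockCode (n L : ℕ) (ε : ℝ) (V : Set (List (Fin n))) : Prop where
  five_le : 5 ≤ n
  pos : 1 ≤ L
  eps_nonneg : 0 ≤ ε
  eps_le : ε ≤ 1
  eps_zero_or : ε = 0 ∨ 6 * (n - 1) ≤ L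
  length_eq : ∀ v ∈ V, v.length = L
  per_eq : ∀ v ∈ V, per v = L
  pair : ∀ u ∈ V, ∀ v ∈ V, u ≠ v → u ++ v ∈ epsThreshold n ε
  exists_ne : ∀ v ∈ V, ∃ u ∈ V, u ≠ v

theorem six_mul_le_cast {n L : ℕ} (hn : 1 ≤ n) (h : 6 * (n - 1) ≤ L) :
    6 * ((n : ℝ) - 1) ≤ L := by
  have : ((6 * (n - 1) : ℕ) : ℝ) ≤ L := by exact_mod_cast h
  rw [Nat.cast_mul, Nat.cast_sub hn] at this
  exact_mod_cast this

theorem three_mul_cast {n : ℕ} (hn : 1 ≤ n) :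
    ((3 * (n - 1) : ℕ) : ℝ) = 3 * ((n : ℝ) - 1) := by
  rw [Nat.cast_mul, Nat.cast_sub hn]
  norm_num

namespace IsBlockCode

variable {n L : ℕ} {ε : ℝ} {V : Set (List (Fin n))}

theorem four_le (h : IsBlockCode n L ε V) : (4 : ℝ) ≤ (n : ℝ) - 1 := by
  have : (5 : ℝ) ≤ n := by exact_mod_cast h.five_le
  linarith

theorem admissible_of_isRep (h : IsBlockCode n L ε V) {u v : List (Fin n)} (hu : u ∈ V)
    (hv : v ∈ V) (huv : u ≠ v) {i p q : ℕ} (hp : 1 ≤ p) (hr : IsRep (u ++ v) i p q) :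
    Admissible n ε p q :=
  (mem_epsThreshold_iff (by have := h.five_le; omega) h.eps_le).1 (h.pair u hu v hv huv) i p q hp hr

theorem getElem?_append (h : IsBlockCode n L ε V) {u : List (Fin n)} (hu : u ∈ V)
    (v : List (Fin n)) (j : ℕ) :
    (u ++ v)[j]? = if j < L then u[j]? else v[j - L]? := by
  rw [List.getElem?_append, h.length_eq u hu]

theorem length_append (h : IsBlockCode n L ε V) {u v : List (Fin n)} (hu : u ∈ V)
    (hv : v ∈ V) : (u ++ v).length = 2 * L := by
  rw [List.length_append, h.length_eq u hu, h.length_eq v hv, two_mul]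

/-- A repetition of period at most `L` satisfies the bound for the period `L`. -/
theorem mul_le_of_admissible (h : IsBlockCode n L ε V) {d q : ℕ} (hd : d ≤ L)
    (ha : Admissible n ε d q) : ((n : ℝ) - 1) * (q + ε) ≤ L := by
  have h4 := h.four_le
  have hdL : (d : ℝ) ≤ L := by exact_mod_cast hd
  rcases h.eps_zero_or with h0 | h6
  · rw [h0, add_zero]; exact ha.1.trans hdL
  by_cases h3 : 3 * (n - 1) ≤ d
  · exact (ha.2 h3).trans hdL
  -- For a short period no bound with `ε` is available, but then `q ≤ 2`, so `q + ε ≤ 3`, and `L ≥ 6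
  -- * (n - 1)` is ample.
  · have h6' := six_mul_le_cast (by have := h.five_le; omega) h6
    have hd3 : (d : ℝ) < 3 * ((n : ℝ) - 1) := by
      rw [← three_mul_cast (by have := h.five_le; omega)]
      exact_mod_cast not_le.1 h3
    have hq : (q : ℝ) < 3 := by
      by_contra hq
      have := ha.1
      nlinarith
    have hq : q < 3 := by exact_mod_cast hq
    have hq : (q : ℝ) ≤ 2 := by exact_mod_cast (by omega : q ≤ 2)
    have := h.eps_le
    nlinarith

theorem eps_mul_le (h : IsBlockCode n L ε V) : ((n : ℝ) - 1) * ε ≤ L := by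
  have h4 := h.four_le
  rcases h.eps_zero_or with h0 | h6
  · rw [h0, mul_zero]; positivity
  · have h6' := six_mul_le_cast (by have := h.five_le; omega) h6
    have := h.eps_le
    nlinarith

/-- No nonempty proper suffix of a word of `V` is a prefix of a word of `V`. -/
theorem no_overlap (h : IsBlockCode n L ε V) {x y : List (Fin n)} (hx : x ∈ V) (hy : y ∈ V)
    {r : ℕ} (h0 : 0 < r) (hr : r < L) (he : ∀ t < r, x[L - r + t]? = y[t]?) : False := by
  have hlx := h.length_eq x hx
  by_cases hxy : x = y
  · subst hxy
    have : per x ≤ L - r := per_le (by omega) (by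
      rw [List.hasPeriod_iff_getElem?]
      intro t ht
      rw [← he t (by omega), add_comm])
    have := h.per_eq x hx
    omega
  · have ha := (h.admissible_of_isRep hx hy hxy (i := L - r) (p := r) (q := r) h0
      ⟨by rw [h.length_append hx hy]; omega, fun t ht => by
        rw [h.getElem?_append hx, h.getElem?_append hx, if_pos (by omega), if_neg (by omega),
          he t ht]
        congr 1; omega⟩).1
    have h4 := h.four_le
    have : (0 : ℝ) < r := by exact_mod_cast h0
    nlinarith

/-- A factor of a word `y ∈ V` which also starts further to the right in `x ∈ V`, and possibly
runs over into the next block `z`. -/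
theorem mul_le_of_shifted (h : IsBlockCode n L ε V) {x y z : List (Fin n)} (hx : x ∈ V)
    (hy : y ∈ V) (hz : z ∈ V) (hxz : x ≠ z) {i j q : ℕ} (hji : j < i) (hi : i < L)
    (hjq : j + q ≤ L) (he : ∀ t < q, (x ++ z)[i + t]? = y[j + t]?) :
    ((n : ℝ) - 1) * (q + ε) ≤ L := by
  by_cases hyx : y = x
  · subst hyx
    refine h.mul_le_of_admissible (d := i - j) (by omega)
      (h.admissible_of_isRep hx hz hxz (i := j) (by omega)
      ⟨by rw [h.length_append hx hz]; omega, fun t ht => ?_⟩)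
    rw [show j + (i - j) + t = i + t by omega, he t ht, h.getElem?_append hx, if_pos (by omega)]
  by_cases hyz : y = z
  · subst hyz
    refine h.mul_le_of_admissible (d := L + j - i) (by omega)
      (h.admissible_of_isRep hx hz hxz (i := i) (by omega)
      ⟨by rw [h.length_append hx hz]; omega, fun t ht => ?_⟩)
    rw [show i + (L + j - i) + t = L + (j + t) by omega, he t ht, h.getElem?_append hx,
      if_neg (by omega), Nat.add_sub_cancel_left]
  by_cases hq : i + q ≤ L
  · refine h.mul_le_of_admissible (d := L + j - i) (by omega)
      (h.admissible_of_isRep hx hy (Ne.symm hyx) (i := i) (by omega)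
      ⟨by rw [h.length_append hx hy]; omega, fun t ht => ?_⟩)
    rw [show i + (L + j - i) + t = L + (j + t) by omega, h.getElem?_append hx,
      h.getElem?_append hx,
      if_pos (by omega), if_neg (by omega), Nat.add_sub_cancel_left, ← he t ht,
      h.getElem?_append hx, if_pos (by omega)]
  -- The factor is cut at the boundary between `x` and `z`. Its first part repeats in `x ++ y` with
  -- period `L + j - i`, its second in `y ++ z` with period `i - j`. The periods add up to `L`, so
  -- the two bounds add up; when `L ≥ 6 * (n - 1)`, one of the periods is at least `3 * (n - 1)` and
  -- contributes `ε`.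
  obtain ⟨s, hs⟩ : ∃ s, s = L - i := ⟨_, rfl⟩
  obtain ⟨r, rfl⟩ : ∃ r, q = s + r := ⟨q - s, by omega⟩
  have h1 : Admissible n ε (L + j - i) s := h.admissible_of_isRep hx hy (Ne.symm hyx) (i := i)
      (by omega) ⟨by rw [h.length_append hx hy]; omega, fun t ht => by
      rw [show i + (L + j - i) + t = L + (j + t) by omega, h.getElem?_append hx,
        h.getElem?_append hx,
        if_pos (by omega), if_neg (by omega), Nat.add_sub_cancel_left, ← he t (by omega),
        h.getElem?_append hx, if_pos (by omega)]⟩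
  have h2 : Admissible n ε (i - j) r := h.admissible_of_isRep hy hz hyz (i := j + s)
      (by omega) ⟨by rw [h.length_append hy hz]; omega, fun t ht => by
      rw [show j + s + (i - j) + t = L + t by omega, h.getElem?_append hy,
        h.getElem?_append hy, if_pos (by omega), if_neg (by omega), Nat.add_sub_cancel_left,
        add_assoc, ← he (s + t) (by omega), h.getElem?_append hx, if_neg (by omega)]
      congr 1; omega⟩
  have hsum : ((L + j - i : ℕ) : ℝ) + ((i - j : ℕ) : ℝ) = L := by
    rw [← Nat.cast_add]; congr 1; omega
  push_cast
  rcases h.eps_zero_or with h0 | h6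
  · rw [h0]; linarith [h1.1, h2.1]
  · rcases (by omega : 3 * (n - 1) ≤ L + j - i ∨ 3 * (n - 1) ≤ i - j) with h3 | h3
    · linarith [h1.2 h3, h2.1]
    · linarith [h2.2 h3, h1.1]

/-- A common factor at the same offset is a repetition of period `L` in `x ++ y`. Any offset is
allowed, so this serves for common prefixes as well as suffixes. -/
theorem mul_le_of_common_suffix (h : IsBlockCode n L ε V) {x y : List (Fin n)} (hx : x ∈ V)
    (hy : y ∈ V) (hxy : x ≠ y) {i q : ℕ} (hq : i + q ≤ L)
    (he : ∀ t < q, x[i + t]? = y[i + t]?) : ((n : ℝ) - 1) * (q + ε) ≤ L := by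
  refine h.mul_le_of_admissible le_rfl (h.admissible_of_isRep hx hy hxy (i := i) h.pos
    ⟨by rw [h.length_append hx hy]; omega, fun t ht => ?_⟩)
  rw [h.getElem?_append hx, h.getElem?_append hx, if_pos (by omega), if_neg (by omega), he t ht]
  congr 1; omega

end IsBlockCode

/-- `W` is the product of the words `B 0, …, B (m - 1)` of length `L`. -/
def IsBlockWord {α : Type*} (L m : ℕ) (B : ℕ → List α) (W : List α) : Prop :=
  W.length = m * L ∧ ∀ c < m, ∀ r < L, W[c * L + r]? = (B c)[r]?

namespace IsBlockCode

variable {n L : ℕ} {ε : ℝ} {V : Set (List (Fin n))}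

theorem getElem?_pair (h : IsBlockCode n L ε V) {m : ℕ} {B : ℕ → List (Fin n)}
    {W : List (Fin n)} (hW : IsBlockWord L m B W) (hB : ∀ c < m, B c ∈ V) {c j : ℕ}
    (hc : c + 1 < m) (hj : j < 2 * L) : W[c * L + j]? = (B c ++ B (c + 1))[j]? := by
  rw [h.getElem?_append (hB c (by omega))]
  split_ifs with hjL
  · exact hW.2 c (by omega) j hjL
  · rw [← hW.2 (c + 1) hc (j - L) (by omega)]
    congr 1
    rw [Nat.add_mul]; omega

/-- A repetition inside two consecutive blocks. -/
theorem admissible_of_isRep_pair (h : IsBlockCode n L ε V) {m : ℕ} {B : ℕ → List (Fin n)}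
    {W : List (Fin n)} (hW : IsBlockWord L m B W) (hB : ∀ c < m, B c ∈ V)
    (hne : ∀ c, c + 1 < m → B c ≠ B (c + 1)) {c i p q : ℕ} (hp : 1 ≤ p) (hc : c + 1 < m)
    (hr : IsRep W (c * L + i) p q) (hi : i + p + q ≤ 2 * L) : Admissible n ε p q := by
  refine h.admissible_of_isRep (hB c (by omega)) (hB _ hc) (hne c hc) (i := i) hp
    ⟨by rwa [h.length_append (hB c (by omega)) (hB _ hc)], fun t ht => ?_⟩
  rw [← h.getElem?_pair hW hB hc (by omega), ← h.getElem?_pair hW hB hc (by omega), ← add_assoc,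
    hr.2 t ht]
  congr 1; omega

end IsBlockCode

namespace IsBlockCode

variable {n L : ℕ} {ε : ℝ} {V : Set (List (Fin n))}

/-- The letters of `W` from position `c * L + i` on, when they do not run beyond block `c + 1`. -/
theorem exists_pair (h : IsBlockCode n L ε V) {m : ℕ} {B : ℕ → List (Fin n)}
    {W : List (Fin n)} (hW : IsBlockWord L m B W) (hB : ∀ c < m, B c ∈ V)
    (hne : ∀ c, c + 1 < m → B c ≠ B (c + 1)) {c i q : ℕ} (hc : c < m)
    (hq : c * L + i + q ≤ W.length) (hi : i + q ≤ 2 * L) :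
    ∃ z ∈ V, B c ≠ z ∧ ∀ t < q, (B c ++ z)[i + t]? = W[c * L + i + t]? := by
  by_cases hm : c + 1 < m
  · refine ⟨_, hB _ hm, hne c hm, fun t ht => ?_⟩
    rw [← h.getElem?_pair hW hB hm (by omega), add_assoc]
  -- The last block has no successor; any different word of `V` may be put after it, as the factor
  -- does not reach it.
  · obtain ⟨z, hz, hzc⟩ := h.exists_ne _ (hB c hc)
    refine ⟨z, hz, hzc.symm, fun t ht => ?_⟩
    obtain rfl : m = c + 1 := by omega
    rw [hW.1, Nat.add_mul] at hq
    rw [h.getElem?_append (hB c hc), if_pos (by omega), add_assoc, hW.2 c hc _ (by omega)]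

/-- A repetition in a block word whose period is not a multiple of the block length. -/
theorem admissible_of_not_dvd (h : IsBlockCode n L ε V) {m : ℕ} {B : ℕ → List (Fin n)}
    {W : List (Fin n)} (hW : IsBlockWord L m B W) (hB : ∀ c < m, B c ∈ V)
    (hne : ∀ c, c + 1 < m → B c ≠ B (c + 1)) {i p q : ℕ} (hr : IsRep W i p q)
    (hq : 0 < q) (hp : ¬ L ∣ p) : Admissible n ε p q := by
  have hL := h.pos
  obtain ⟨a, i₀, hi₀, rfl⟩ : ∃ a i₀, i₀ < L ∧ i = a * L + i₀ :=
    ⟨i / L, i % L, Nat.mod_lt _ hL, (Nat.div_add_mod' i L).symm⟩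
  obtain ⟨c, j₀, hj₀, hj⟩ : ∃ c j₀, j₀ < L ∧ a * L + i₀ + p = c * L + j₀ :=
    ⟨(a * L + i₀ + p) / L, (a * L + i₀ + p) % L, Nat.mod_lt _ hL, (Nat.div_add_mod' _ L).symm⟩
  have hp1 : 1 ≤ p := Nat.pos_of_ne_zero (by rintro rfl; exact hp (dvd_zero _))
  have hij : i₀ ≠ j₀ := by
    rintro rfl
    apply hp
    have h1 : a * L + p = c * L := by omega
    exact (Nat.dvd_add_right (Dvd.intro_left a rfl)).1 (h1 ▸ Dvd.intro_left c rfl)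
  obtain ⟨hlen, heq⟩ := hr
  rw [hW.1] at hlen
  have hac : a ≤ c := by
    by_contra hca
    have := Nat.mul_le_mul_right L (not_le.1 hca)
    rw [Nat.succ_mul] at this
    omega
  have hcm : c < m := by
    by_contra hca
    have := Nat.mul_le_mul_right L (not_lt.1 hca)
    omega
  have ham : a < m := by omega
  have heq' : ∀ t < q, W[a * L + (i₀ + t)]? = W[c * L + (j₀ + t)]? := fun t ht => by
    have := heq t ht
    rwa [hj, add_assoc, add_assoc] at this
  obtain ⟨k, rfl⟩ := Nat.exists_eq_add_of_le hac
  rw [Nat.add_mul] at hj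
  have hbound : ((n : ℝ) - 1) * (q + ε) ≤ L → L ≤ p → Admissible n ε p q := by
    intro h1 h2
    have h2 : (L : ℝ) ≤ p := by exact_mod_cast h2
    have h4 := h.four_le
    have := h.eps_nonneg
    exact ⟨by nlinarith, fun _ => h1.trans h2⟩
  have hkL : k = 0 ∨ k = 1 ∨ 2 * L ≤ k * L := by
    rcases Nat.lt_or_ge k 2 with hk | hk
    · omega
    · exact Or.inr (Or.inr (Nat.mul_le_mul_right L hk))
  have hlast : ∀ b j, b < m → b * L + j < m * L → L ≤ j → b + 1 < m := by
    intro b j h1 h2 h3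
    by_contra h4
    obtain rfl : m = b + 1 := by omega
    rw [Nat.add_mul] at h2
    omega
  have hnext : ∀ b j, L ≤ j → b * L + j = (b + 1) * L + (j - L) := by
    intro b j h1
    rw [Nat.add_mul]; omega
  rcases Nat.lt_or_ge j₀ i₀ with hlt | hge
  -- If the occurrence with the smaller offset reached the end of its block, the other one would
  -- already have entered a new block. A prefix of that block, of length `i₀ - j₀`, would then be a
  -- proper suffix of the first.
  · have hjq : j₀ + q < L := by
      by_contra hcon
      have hk1 : a + 1 < m := by
        rcases hkL with rfl | hk | hk
        · omega
        · omega
        · by_contra h1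
          have : k = 0 := by omega
          subst this; omega
      refine h.no_overlap (hB _ hcm) (hB _ hk1) (r := i₀ - j₀) (by omega) (by omega)
        fun t ht => ?_
      rw [← hW.2 _ hcm _ (by omega), ← hW.2 _ hk1 _ (by omega)]
      have := heq' (L - i₀ + t) (by omega)
      rw [hnext a _ (by omega)] at this
      rw [show L - (i₀ - j₀) + t = j₀ + (L - i₀ + t) by omega, ← this]
      congr 2; omega
    rcases hkL with rfl | rfl | hk
    · omega
    · exact h.admissible_of_isRep_pair hW hB hne (c := a) (i := i₀) hp1 hcm
        ⟨by rw [hW.1]; exact hlen, heq⟩ (by omega)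
    · refine hbound ?_ (by omega)
      obtain ⟨z, hz, haz, hz'⟩ := h.exists_pair hW hB hne ham (i := i₀) (q := q)
        (by rw [hW.1]; omega) (by omega)
      refine h.mul_le_of_shifted (hB a ham) (hB _ hcm) hz haz hlt hi₀ hjq.le fun t ht => ?_
      rw [hz' t ht, ← hW.2 _ hcm _ (by omega), ← heq' t ht, add_assoc]
  · have hiq : i₀ + q < L := by
      by_contra hcon
      have hk1 : a + k + 1 < m := hlast (a + k) (j₀ + (q - 1)) hcm (by
        rw [Nat.add_mul]; omega) (by omega)
      refine h.no_overlap (hB _ ham) (hB _ hk1) (r := j₀ - i₀) (by omega) (by omega)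
        fun t ht => ?_
      rw [← hW.2 _ ham _ (by omega), ← hW.2 _ hk1 _ (by omega)]
      have := heq' (L - j₀ + t) (by omega)
      rw [hnext (a + k) _ (by omega)] at this
      rw [show L - (j₀ - i₀) + t = i₀ + (L - j₀ + t) by omega, this]
      congr 2; omega
    have hp' : p = k * L + j₀ - i₀ := by omega
    obtain ⟨z, hz, haz, hz'⟩ := h.exists_pair hW hB hne hcm (i := j₀) (q := q)
      (by rw [hW.1, Nat.add_mul]; omega) (by omega)
    have hk0 : k = 0 ∨ L ≤ k * L := by
      rcases hkL with hk | rfl | hk <;> omega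
    rcases hk0 with rfl | hk
    · refine h.admissible_of_isRep (hB _ hcm) hz haz (i := i₀) hp1
        ⟨by rw [h.length_append (hB _ hcm) hz]; omega, fun t ht => ?_⟩
      rw [show i₀ + p + t = j₀ + t by omega, hz' t ht, h.getElem?_append (hB _ hcm),
        if_pos (by omega), ← hW.2 _ hcm _ (by omega), add_assoc, ← heq' t ht]
      rfl
    · refine hbound ?_ (by omega)
      refine h.mul_le_of_shifted (hB _ hcm) (hB a ham) hz haz (by omega) hj₀ hiq.le
        fun t ht => ?_
      rw [hz' t ht, ← hW.2 _ ham _ (by omega), heq' t ht, add_assoc]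

end IsBlockCode

/-! ### Periods that are multiples of the block length -/

/-- The repeated part, of length `q`, of a repetition whose period is `k` blocks: `h` complete
blocks, preceded by a common suffix of length `s` and followed by a common prefix of length `r`
of different blocks. -/
structure AlignedRep {α : Type*} (L m k q : ℕ) (B : ℕ → List α) (a h s r : ℕ) : Prop where
  le : q ≤ s + h * L + r
  add_le : a + h + k ≤ m
  eq : ∀ c, a ≤ c → c < a + h → B c = B (c + k)
  suff : s = 0 ∨ 1 ≤ a ∧ s ≤ L ∧ B (a - 1) ≠ B (a - 1 + k) ∧
    ∀ t < s, (B (a - 1))[L - s + t]? = (B (a - 1 + k))[L - s + t]?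
  pref : r = 0 ∨ a + h + k < m ∧ r ≤ L ∧ B (a + h) ≠ B (a + h + k) ∧
    ∀ t < r, (B (a + h))[t]? = (B (a + h + k))[t]?

/-- Blocks at distance `k` are compared one by one. A partly covered block that happens to equal its
partner is counted as complete; this is why `AlignedRep` bounds `q` only from above, and why its
partial blocks can be taken different. The first alternative is a repeated part strictly inside one
block. -/
theorem IsBlockCode.alignedRep {n L : ℕ} {ε : ℝ} {V : Set (List (Fin n))}
    (h : IsBlockCode n L ε V) {m : ℕ} {B : ℕ → List (Fin n)} {W : List (Fin n)}
    (hW : IsBlockWord L m B W) (hB : ∀ c < m, B c ∈ V) {i k q : ℕ}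
    (hr : IsRep W i (k * L) q) (hq : 0 < q) :
    ((n : ℝ) - 1) * (q + ε) ≤ L ∨ ∃ a h s r, AlignedRep L m k q B a h s r := by
  have hL := h.pos
  obtain ⟨hlen, heq⟩ := hr
  rw [hW.1] at hlen
  have hmem : ∀ c r, r < L → c * L + r + k * L < m * L → c + k < m := by
    intro c r _ h1
    by_contra h2
    have := Nat.mul_le_mul_right L (not_lt.1 h2)
    rw [Nat.add_mul] at this
    omega
  have hblock : ∀ c r, r < L → i ≤ c * L + r → c * L + r < i + q →
      c + k < m ∧ (B c)[r]? = (B (c + k))[r]? := by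
    intro c r hr h1 h2
    have hck := hmem c r hr (by omega)
    refine ⟨hck, ?_⟩
    rw [← hW.2 _ hck _ hr, ← hW.2 c (by omega) _ hr]
    have := heq (c * L + r - i) (by omega)
    rw [show i + (c * L + r - i) = c * L + r by omega,
      show i + k * L + (c * L + r - i) = (c + k) * L + r by rw [Nat.add_mul]; omega] at this
    exact this
  have hfull : ∀ c, c + k < m → i ≤ c * L → (c + 1) * L ≤ i + q → B c = B (c + k) := by
    intro c hck h1 h2
    rw [Nat.add_mul] at h2
    apply List.ext_getElem?
    intro r
    rcases Nat.lt_or_ge r L with hr | hr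
    · exact (hblock c r hr (by omega) (by omega)).2
    · rw [List.getElem?_eq_none (by rw [h.length_eq _ (hB c (by omega))]; exact hr),
        List.getElem?_eq_none (by rw [h.length_eq _ (hB _ hck)]; exact hr)]
  -- `a` is the first block boundary at or after `i`, and `e` below the last one at or before `i +
  -- q`; `e < a` means that no boundary is met.
  obtain ⟨a, i₀, hi₀, hi⟩ : ∃ a i₀, i₀ < L ∧ i + i₀ = a * L := by
    obtain ⟨e, he⟩ : ∃ e, e = i / L := ⟨_, rfl⟩
    have h1 := Nat.div_add_mod i L
    have h2 := Nat.mod_lt i hL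
    rw [← he, mul_comm] at h1
    rcases Nat.eq_zero_or_pos (i % L) with h3 | h3
    · exact ⟨e, 0, hL, by omega⟩
    · exact ⟨e + 1, L - i % L, by omega, by rw [Nat.add_mul]; omega⟩
  obtain ⟨e, j₀, hj₀, hj⟩ : ∃ e j₀, j₀ < L ∧ i + q = e * L + j₀ :=
    ⟨(i + q) / L, (i + q) % L, Nat.mod_lt _ hL, (Nat.div_add_mod' _ L).symm⟩
  rcases Nat.lt_or_ge e a with hea | hae
  · have h1 := Nat.mul_le_mul_right L (show e + 1 ≤ a from hea)
    rw [Nat.add_mul] at h1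
    have h2 := hblock e (j₀ - 1) (by omega) (by omega) (by omega)
    by_cases hBe : B e = B (e + k)
    · refine Or.inr ⟨e, 1, 0, 0, by omega, by omega, ?_, Or.inl rfl, Or.inl rfl⟩
      intro c h3 h4
      obtain rfl : c = e := by omega
      exact hBe
    · refine Or.inl (h.mul_le_of_common_suffix (hB e (by omega)) (hB _ h2.1) hBe
        (i := i - e * L) (by omega) fun t ht => ?_)
      exact (hblock e _ (by omega) (by omega) (by omega)).2
  right
  obtain ⟨d, rfl⟩ := Nat.exists_eq_add_of_le hae
  rw [Nat.add_mul] at hj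
  have hadk : a + d + k ≤ m := by
    by_contra h2
    have := Nat.mul_le_mul_right L (not_le.1 h2)
    simp only [Nat.add_mul, Nat.succ_mul] at this
    omega
  have hin : ∀ c, a ≤ c → c < a + d → B c = B (c + k) := by
    intro c h1 h2
    have h3 := Nat.mul_le_mul_right L h1
    have h4 := Nat.mul_le_mul_right L (show c + 1 ≤ a + d from h2)
    rw [Nat.add_mul a] at h4
    exact hfull c (by omega) (by omega) (by omega)
  obtain ⟨d', r, hd, hrle, hadk', hin', hpref⟩ : ∃ d' r, d ≤ d' ∧ d * L + j₀ ≤ d' * L + r ∧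
      a + d' + k ≤ m ∧ (∀ c, a ≤ c → c < a + d' → B c = B (c + k)) ∧
      (r = 0 ∨ a + d' + k < m ∧ r ≤ L ∧ B (a + d') ≠ B (a + d' + k) ∧
        ∀ t < r, (B (a + d'))[t]? = (B (a + d' + k))[t]?) := by
    rcases Nat.eq_zero_or_pos j₀ with h0 | h0
    · exact ⟨d, 0, le_rfl, by omega, hadk, hin, Or.inl rfl⟩
    have h1 : a + d + k < m ∧ ∀ t < j₀, (B (a + d))[t]? = (B (a + d + k))[t]? := by
      have key : ∀ t < j₀, a + d + k < m ∧ (B (a + d))[t]? = (B (a + d + k))[t]? :=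
        fun t ht => hblock (a + d) t (by omega) (by rw [Nat.add_mul]; omega)
          (by rw [Nat.add_mul]; omega)
      exact ⟨(key 0 h0).1, fun t ht => (key t ht).2⟩
    by_cases hBe : B (a + d) = B (a + d + k)
    · refine ⟨d + 1, 0, by omega, by rw [Nat.add_mul]; omega, by omega, fun c h2 h3 => ?_,
        Or.inl rfl⟩
      rcases (by omega : c < a + d ∨ c = a + d) with h4 | rfl
      · exact hin c h2 h4
      · exact hBe
    · exact ⟨d, j₀, le_rfl, le_rfl, hadk, hin, Or.inr ⟨h1.1, hj₀.le, hBe, h1.2⟩⟩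
  rcases Nat.eq_zero_or_pos i₀ with h0 | h0
  · exact ⟨a, d', 0, r, by omega, hadk', hin', Or.inl rfl, hpref⟩
  have ha : 1 ≤ a := by
    rcases Nat.eq_zero_or_pos a with rfl | ha
    · omega
    · exact ha
  obtain ⟨a, rfl⟩ := Nat.exists_eq_add_of_le' ha
  rw [Nat.add_mul] at hi hj
  have key : ∀ t < i₀, (B a)[L - i₀ + t]? = (B (a + k))[L - i₀ + t]? := fun t ht =>
    (hblock a (L - i₀ + t) (by omega) (by omega) (by omega)).2
  by_cases hBa : B a = B (a + k)
  · refine ⟨a, d' + 1, 0, r, by rw [Nat.add_mul]; omega, by omega, fun c h2 h3 => ?_,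
      Or.inl rfl, ?_⟩
    · rcases (by omega : c = a ∨ a + 1 ≤ c) with rfl | h4
      · exact hBa
      · exact hin' c h4 (by omega)
    · rwa [show a + (d' + 1) = a + 1 + d' by omega]
  · refine ⟨a + 1, d', i₀, r, by omega, hadk', hin', Or.inr ⟨ha, hi₀.le, ?_, ?_⟩, hpref⟩
    · simpa using hBa
    · simpa using key



/-! ### Gaps and counts of letters -/

section InitialWord

variable {α : Type*}

theorem initialWord_length (a : ℕ → α) (m : ℕ) : (initialWord a m).length = m := by
  simp [initialWord]

theorem initialWord_succ (a : ℕ → α) (m : ℕ) :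
    initialWord a (m + 1) = initialWord a m ++ [a m] := by
  simp [initialWord, List.range_succ]

theorem initialWord_getElem? (a : ℕ → α) {m i : ℕ} (hi : i < m) :
    (initialWord a m)[i]? = some (a i) := by
  simp [initialWord, hi]

/-- Finite words are treated as beginnings of infinite ones, so that letters have total indexing.
The filler beyond the end is irrelevant. -/
theorem exists_eq_initialWord [Inhabited α] (w : List α) :
    ∃ a : ℕ → α, w = initialWord a w.length := by
  refine ⟨fun i => w[i]?.getD default, List.ext_getElem? fun i => ?_⟩
  rcases Nat.lt_or_ge i w.length with h | h
  · rw [initialWord_getElem? _ h, List.getElem?_eq_getElem h]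
    rfl
  · rw [List.getElem?_eq_none h, List.getElem?_eq_none (by rwa [initialWord_length])]

theorem isRep_initialWord {a : ℕ → α} {m i p q : ℕ} (hm : i + p + q ≤ m)
    (h : ∀ t < q, a (i + t) = a (i + p + t)) : IsRep (initialWord a m) i p q :=
  ⟨by rwa [initialWord_length], fun t ht => by
    rw [initialWord_getElem? _ (by omega), initialWord_getElem? _ (by omega), h t ht]⟩

/-- Equal letters of a word over `n` letters in the threshold set are at distance at least
`n - 1`. -/
theorem le_of_letter_eq {n : ℕ} (hn : 2 ≤ n) {a : ℕ → Fin n} {m : ℕ}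
    (ha : initialWord a m ∈ threshold n) {i j : ℕ} (hij : i < j) (hj : j < m)
    (h : a i = a j) : n - 1 ≤ j - i := by
  have := (mem_threshold_iff hn).1 ha i (j - i) 1 (by omega)
    (isRep_initialWord (by omega) fun t ht => by
      obtain rfl : t = 0 := by omega
      rw [add_zero, add_zero, h]; congr 1; omega)
  rw [← Nat.cast_le (α := ℝ), Nat.cast_sub (by omega)]
  simpa using this

variable [DecidableEq α]

theorem count_initialWord_succ (a : ℕ → α) (x : α) (m : ℕ) :
    (initialWord a (m + 1)).count x = (initialWord a m).count x + if a m = x then 1 else 0 := by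
  rw [initialWord_succ, List.count_append, List.count_singleton]
  simp

theorem count_initialWord_mono (a : ℕ → α) (x : α) (c j : ℕ) :
    (initialWord a c).count x ≤ (initialWord a (c + j)).count x := by
  induction j with
  | zero => rfl
  | succ j ih => rw [← add_assoc, count_initialWord_succ]; omega

theorem count_initialWord_eq {a : ℕ → α} {x : α} {c j : ℕ}
    (h : ∀ t, c ≤ t → t < c + j → a t ≠ x) :
    (initialWord a (c + j)).count x = (initialWord a c).count x := by
  induction j with
  | zero => rfl
  | succ j ih =>
    rw [← add_assoc, count_initialWord_succ, if_neg (h _ (by omega) (by omega)),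
      ih fun t h1 h2 => h t h1 (by omega), add_zero]

theorem exists_count_eq {a : ℕ → α} {x : α} {c H d : ℕ}
    (h1 : (initialWord a c).count x ≤ d) (h2 : d < (initialWord a (c + H)).count x) :
    ∃ t, c ≤ t ∧ t < c + H ∧ a t = x ∧ (initialWord a t).count x = d := by
  induction H with
  | zero => rw [add_zero] at h2; omega
  | succ H ih =>
    rw [← add_assoc, count_initialWord_succ] at h2
    rcases Nat.lt_or_ge d ((initialWord a (c + H)).count x) with h3 | h3
    · obtain ⟨t, h4, h5, h6⟩ := ih h3
      exact ⟨t, h4, by omega, h6⟩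
    · by_cases hx : a (c + H) = x
      · rw [if_pos hx] at h2
        exact ⟨c + H, by omega, by omega, hx, by omega⟩
      · rw [if_neg hx] at h2; omega

/-- A window of length at most `g` contains at most one occurrence of a letter whose occurrences
are at distance at least `g`. -/
theorem count_window_le {a : ℕ → α} {m g : ℕ}
    (hg : ∀ i j, i < j → j < m → a i = a j → g ≤ j - i) (x : α) {r c j : ℕ}
    (hj : j ≤ r * g) (hm : c + j ≤ m) :
    (initialWord a (c + j)).count x ≤ (initialWord a c).count x + r := by
  have one : ∀ c j, j ≤ g → c + j ≤ m →
      (initialWord a (c + j)).count x ≤ (initialWord a c).count x + 1 := by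
    intro c j
    induction j with
    | zero => intro _ _; simp
    | succ j ih =>
      intro h1 h2
      rw [← add_assoc, count_initialWord_succ]
      by_cases hx : a (c + j) = x
      · rw [if_pos hx, count_initialWord_eq]
        intro t h3 h4 h5
        have := hg t (c + j) h4 (by omega) (h5.trans hx.symm)
        omega
      · rw [if_neg hx, add_zero]
        exact ih (by omega) (by omega)
  induction r generalizing j with
  | zero => obtain rfl : j = 0 := by omega
            simp
  | succ r ih =>
    rw [Nat.succ_mul] at hj
    have h1 := ih (j := j - min j g) (by omega) (by omega)
    have h2 := one (c + (j - min j g)) (min j g) (by omega) (by omega)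
    rw [show c + (j - min j g) + min j g = c + j by omega] at h2
    omega

/-- Counts that are congruent modulo 3 but not equal differ by at least 3. So `k + 1` consecutive
letters contain four occurrences, whereas a window of length at most `3 * g` has room for three. -/
theorem three_mul_le_of_count_mod {a : ℕ → α} {m g : ℕ}
    (hg : ∀ i j, i < j → j < m → a i = a j → g ≤ j - i) {c k : ℕ} (hk : 1 ≤ k)
    (hm : c + k < m) (h : a c = a (c + k))
    (hc : (initialWord a c).count (a c) % 3 = (initialWord a (c + k)).count (a c) % 3) :
    3 * g ≤ k := by
  by_contra hlt
  have h1 := count_window_le hg (a c) (r := 3) (c := c) (j := k + 1) (by omega) (by omega)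
  rw [← add_assoc, count_initialWord_succ, if_pos h.symm] at h1
  have h2 := count_initialWord_mono a (a c) (c + 1) (k - 1)
  rw [count_initialWord_succ, if_pos rfl, show c + 1 + (k - 1) = c + k by omega] at h2
  omega

end InitialWord

/-! ### Images as block words, and the reduction to complete repeated blocks -/

theorem substFrom_append {α β : Type*} (F : List α → α → List β) (u w z : List α) :
    substFrom F u (w ++ z) = substFrom F u w ++ substFrom F (u ++ w) z := by
  induction w generalizing u with
  | nil => simp [substFrom]
  | cons a w ih => simp [substFrom, ih]

theorem subst_initialWord_succ {α β : Type*} (F : List α → α → List β) (a : ℕ → α) (m : ℕ) :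
    subst F (initialWord a (m + 1)) =
      subst F (initialWord a m) ++ F (initialWord a m) (a m) := by
  simp [initialWord_succ, subst, substFrom_append, substFrom]

theorem isBlockWord_subst {α β : Type*} {F : List α → α → List β} {L : ℕ}
    (hF : ∀ u a, (F u a).length = L) (a : ℕ → α) (m : ℕ) :
    IsBlockWord L m (fun c => F (initialWord a c) (a c)) (subst F (initialWord a m)) := by
  induction m with
  | zero => exact ⟨by simp [initialWord, subst, substFrom], fun c hc => by omega⟩
  | succ m ih =>
    refine ⟨by rw [subst_initialWord_succ, List.length_append, ih.1, hF, Nat.succ_mul],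
      fun c hc r hr => ?_⟩
    rw [subst_initialWord_succ, List.getElem?_append, ih.1]
    rcases (by omega : c < m ∨ c = m) with h | rfl
    · have := Nat.mul_le_mul_right L (show c + 1 ≤ m from h)
      rw [Nat.add_mul] at this
      rw [if_pos (by omega), ih.2 c h r hr]
    · rw [if_neg (by omega), Nat.add_sub_cancel_left]

/-- Replacement loses no information: `v'` is not a value of `F`, so a block `v'` must stand for
`v`. Repetitions of blocks therefore descend to the preimage. -/
theorem eq_of_replaceRule_eq {α β : Type*} {F : List α → α → List β} {v v' : List β} {S : Set ℕ}
    (hv' : ∀ u a, v' ≠ F u a) {u u' : List α} {a a' : α}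
    (h : replaceRule F v v' S u a = replaceRule F v v' S u' a') : F u a = F u' a' := by
  unfold replaceRule at h
  split_ifs at h with h1 h2 h2
  · rw [h1.1, h2.1]
  · exact absurd h (hv' _ _)
  · exact absurd h.symm (hv' _ _)
  · exact h

theorem replaceRule_mem_imagesWith {α β : Type*} {F : List α → α → List β} {v v' : List β}
    {I : α → Set (List β)} (hF : ∀ u a, F u a ∈ I a) (S : Set ℕ) (u : List α) (a : α) :
    replaceRule F v v' S u a ∈ imagesWith I v v' a := by
  unfold replaceRule
  split_ifs with h
  · exact Or.inr ⟨rfl, h.1 ▸ hF u a⟩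
  · exact Or.inl (hF u a)

theorem imagesWith_disjoint {α β : Type*} {I : α → Set (List β)} {v v' : List β}
    (hI : ∀ a b x, x ∈ I a → x ∈ I b → a = b) (hv' : ∀ a, v' ∉ I a) {a b : α} {x : List β}
    (ha : x ∈ imagesWith I v v' a) (hb : x ∈ imagesWith I v v' b) : a = b := by
  rcases ha with ha | ⟨rfl, ha⟩ <;> rcases hb with hb | ⟨h, hb⟩
  · exact hI a b x ha hb
  · exact absurd (h ▸ ha) (hv' a)
  · exact absurd hb (hv' b)
  · exact hI a b v ha hb

theorem take_eq_take_of_getElem? {α : Type*} {x y : List α} {r : ℕ}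
    (h : ∀ t < r, x[t]? = y[t]?) : x.take r = y.take r := by
  refine List.ext_getElem? fun t => ?_
  rw [List.getElem?_take, List.getElem?_take]
  split_ifs with ht
  · exact h t ht
  · rfl

theorem drop_eq_drop_of_getElem? {α : Type*} {x y : List α} {L s : ℕ} (hx : x.length = L)
    (hy : y.length = L) (hs : s ≤ L) (h : ∀ t < s, x[L - s + t]? = y[L - s + t]?) :
    x.drop (L - s) = y.drop (L - s) := by
  refine List.ext_getElem? fun t => ?_
  rw [List.getElem?_drop, List.getElem?_drop]
  rcases Nat.lt_or_ge t s with ht | ht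
  · exact h t ht
  · rw [List.getElem?_eq_none (by omega), List.getElem?_eq_none (by omega)]

/-- Repetitions in the image of a word: the bound holds except possibly for repetitions whose
repeated part contains a complete block and whose period is a multiple of the block length. -/
theorem IsBlockCode.admissible_or_alignedRep {α : Type*} {n L : ℕ} {ε : ℝ}
    {V : Finset (List (Fin n))} (h : IsBlockCode n L ε (V : Set (List (Fin n))))
    {J : α → Set (List (Fin n))}
    (hJ : ∀ a b x, x ∈ J a → x ∈ J b → a = b) (hO : OverlapCondition n L ε V J)
    {a : ℕ → α} {m : ℕ} (ha : ∀ i j, i < j → j ≤ i + 2 → j < m → a i ≠ a j)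
    {B : ℕ → List (Fin n)} (hB : ∀ c < m, B c ∈ V) (hBJ : ∀ c < m, B c ∈ J (a c))
    {W : List (Fin n)} (hW : IsBlockWord L m B W) {i p q : ℕ} (hp : 1 ≤ p)
    (hr : IsRep W i p q) :
    Admissible n ε p q ∨ ∃ k b d s r, p = k * L ∧ 1 ≤ k ∧ 1 ≤ d ∧ s ≤ L ∧ r ≤ L ∧
      ((n : ℝ) - 1) * (s + ε) ≤ L ∧ ((n : ℝ) - 1) * (r + ε) ≤ L ∧
      AlignedRep L m k q B b d s r := by
  have h4 := h.four_le
  have hε := h.eps_nonneg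
  have hadm : ((n : ℝ) - 1) * (q + ε) ≤ p → Admissible n ε p q := fun h1 =>
    ⟨by nlinarith, fun _ => h1⟩
  by_cases hpL : L ∣ p
  swap
  · rcases Nat.eq_zero_or_pos q with rfl | hq
    · refine Or.inl ⟨by simp, fun h3 => ?_⟩
      have h3 : ((3 * (n - 1) : ℕ) : ℝ) ≤ p := by exact_mod_cast h3
      rw [three_mul_cast (by have := h.five_le; omega)] at h3
      have := h.eps_le
      push_cast
      nlinarith
    · refine Or.inl (h.admissible_of_not_dvd hW hB (fun c hc he => ?_) hr hq hpL)
      exact ha c (c + 1) (by omega) (by omega) hc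
        (hJ _ _ _ (hBJ c (by omega)) (he ▸ hBJ _ hc))
  obtain ⟨k, rfl⟩ := hpL
  rw [mul_comm L k] at *
  have hk : 1 ≤ k := Nat.pos_of_ne_zero (by rintro rfl; omega)
  have hLk : (L : ℝ) ≤ ((k * L : ℕ) : ℝ) := by
    exact_mod_cast Nat.le_mul_of_pos_left L hk
  rcases Nat.eq_zero_or_pos q with rfl | hq
  · refine Or.inl (hadm ?_)
    have := h.eps_mul_le
    rw [Nat.cast_zero, zero_add]
    exact this.trans hLk
  rcases h.alignedRep hW hB hr hq with h1 | ⟨b, d, s, r, hA⟩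
  · exact Or.inl (hadm (h1.trans hLk))
  have hsb : s ≤ L ∧ ((n : ℝ) - 1) * (s + ε) ≤ L := by
    rcases hA.suff with rfl | ⟨hb, hsL, hne, hs⟩
    · refine ⟨Nat.zero_le _, ?_⟩
      simpa using h.eps_mul_le
    · have := hA.add_le
      refine ⟨hsL, h.mul_le_of_common_suffix (hB (b - 1) (by omega)) (hB (b - 1 + k) (by omega))
        hne (by omega) hs⟩
  have hrb : r ≤ L ∧ ((n : ℝ) - 1) * (r + ε) ≤ L := by
    rcases hA.pref with rfl | ⟨hb, hrL, hne, hr⟩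
    · refine ⟨Nat.zero_le _, ?_⟩
      simpa using h.eps_mul_le
    · refine ⟨hrL, h.mul_le_of_common_suffix (hB (b + d) (by omega)) (hB _ hb) hne
        (i := 0) (by omega) fun t ht => ?_⟩
      rw [zero_add]; exact hr t ht
  rcases Nat.eq_zero_or_pos d with rfl | hd
  swap
  · exact Or.inr ⟨k, b, d, s, r, rfl, hk, hd, hsb.1, hrb.1, hsb.2, hrb.2, hA⟩
  left
  apply hadm
  have hq : (q : ℝ) ≤ s + r := by
    have := hA.le
    rw [zero_mul, add_zero] at this
    exact_mod_cast this
  suffices hsuff : ((n : ℝ) - 1) * (s + r + ε) ≤ ((k * L : ℕ) : ℝ) by nlinarith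
  -- For `k ≥ 2` the bounds for `s` and `r` separately, each by `L`, add up to at most the period.
  rcases (by omega : k = 1 ∨ 2 ≤ k) with rfl | hk2
  swap
  · have : ((2 * L : ℕ) : ℝ) ≤ ((k * L : ℕ) : ℝ) := by
      exact_mod_cast Nat.mul_le_mul_right L hk2
    push_cast at this ⊢
    nlinarith [hsb.2, hrb.2]
  rw [one_mul]
  rcases hA.suff with rfl | ⟨hb, hsL, hne, hs'⟩
  · simpa using hrb.2
  rcases hA.pref with rfl | ⟨hbm, hrL, hne', hr'⟩
  · simpa using hsb.2
  obtain ⟨b, rfl⟩ := Nat.exists_eq_add_of_le' hb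
  simp only [Nat.add_sub_cancel, add_zero] at *
  have hnot : ∀ c, c < m → a c ≠ a (b + 1) → B c ∉ J (a (b + 1)) := fun c hc hne hmem =>
    hne (hJ _ _ _ (hBJ c hc) hmem)
  -- For `k = 1` the repetition lives in three consecutive blocks: the middle one shares a suffix
  -- with its predecessor and a prefix with its successor. The overlap condition is used for the
  -- middle letter, with `x = x'`.
  have hO' := hO (a (b + 1)) (B (b + 1 + 1)) (hB _ hbm)
    (hnot _ hbm (ha _ _ (by omega) (by omega) hbm).symm)
    (B b) (hB _ (by omega)) (hnot _ (by omega) (ha _ _ (by omega) (by omega) (by omega)))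
    (fun he => ha b (b + 1 + 1) (by omega) (by omega) hbm
      (hJ _ _ _ (hBJ b (by omega)) (he ▸ hBJ _ hbm)))
    (B (b + 1)) (hBJ _ (by omega)) (B (b + 1)) (hBJ _ (by omega))
    ((B (b + 1 + 1)).take r) ((B b).drop (L - s)) (List.take_prefix _ _)
    (by rw [← take_eq_take_of_getElem? hr']; exact List.take_prefix _ _)
    (by
      rw [drop_eq_drop_of_getElem? (h.length_eq _ (hB b (by omega)))
        (h.length_eq _ (hB (b + 1) (by omega))) hsL hs']
      exact List.drop_suffix _ _)
    (List.drop_suffix _ _)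
  rw [List.length_take, List.length_drop, h.length_eq _ (hB _ hbm),
    h.length_eq _ (hB b (by omega)), min_eq_left hrL, show L - (L - s) = s by omega,
    le_div_iff₀ (by linarith)] at hO'
  linarith



/-! ### The parameter `ε`, and images under the cyclic substitution -/

section CommonPrefix

variable {α : Type*} {V : Finset (List α)} {L : ℕ}

theorem bddAbove_commonPrefix (hV : ∀ v ∈ V, v.length = L) :
    BddAbove {m : ℕ | ∃ u ∈ V, ∃ v ∈ V, u ≠ v ∧ ∃ x : List α, x <+: u ∧ x <+: v ∧ x.length = m} := by
  refine ⟨L, ?_⟩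
  rintro _ ⟨u, hu, v, -, -, x, hx, -, rfl⟩
  exact (hV u hu) ▸ hx.length_le

theorem bddAbove_commonSuffix (hV : ∀ v ∈ V, v.length = L) :
    BddAbove {m : ℕ | ∃ u ∈ V, ∃ v ∈ V, u ≠ v ∧ ∃ x : List α, x <:+ u ∧ x <:+ v ∧ x.length = m} := by
  refine ⟨L, ?_⟩
  rintro _ ⟨u, hu, v, -, -, x, hx, -, rfl⟩
  exact (hV u hu) ▸ hx.length_le

theorem exists_maxCommonPrefix (hV : ∀ v ∈ V, v.length = L) (hc : 1 < V.card) :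
    ∃ u ∈ V, ∃ v ∈ V, u ≠ v ∧ ∃ x : List α, x <+: u ∧ x <+: v ∧
      x.length = maxCommonPrefix V := by
  obtain ⟨u, hu, v, hv, huv⟩ := Finset.one_lt_card.1 hc
  exact Nat.sSup_mem (s := {m : ℕ | ∃ u ∈ V, ∃ v ∈ V, u ≠ v ∧ ∃ x : List α, x <+: u ∧ x <+: v ∧
    x.length = m}) ⟨0, u, hu, v, hv, huv, [], List.nil_prefix, List.nil_prefix, rfl⟩
    (bddAbove_commonPrefix hV)

theorem exists_maxCommonSuffix (hV : ∀ v ∈ V, v.length = L) (hc : 1 < V.card) :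
    ∃ u ∈ V, ∃ v ∈ V, u ≠ v ∧ ∃ x : List α, x <:+ u ∧ x <:+ v ∧
      x.length = maxCommonSuffix V := by
  obtain ⟨u, hu, v, hv, huv⟩ := Finset.one_lt_card.1 hc
  exact Nat.sSup_mem (s := {m : ℕ | ∃ u ∈ V, ∃ v ∈ V, u ≠ v ∧ ∃ x : List α, x <:+ u ∧ x <:+ v ∧
    x.length = m}) ⟨0, u, hu, v, hv, huv, [], List.nil_suffix, List.nil_suffix, rfl⟩
    (bddAbove_commonSuffix hV)

theorem le_maxCommonPrefix (hV : ∀ v ∈ V, v.length = L) {x y : List α} (hx : x ∈ V) (hy : y ∈ V)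
    (hxy : x ≠ y) {r : ℕ} (hr : r ≤ L) (h : ∀ t < r, x[t]? = y[t]?) :
    r ≤ maxCommonPrefix V := by
  refine le_csSup (bddAbove_commonPrefix hV) ⟨x, hx, y, hy, hxy, x.take r, List.take_prefix _ _,
    ?_, by rw [List.length_take, hV x hx, min_eq_left hr]⟩
  rw [take_eq_take_of_getElem? h]
  exact List.take_prefix _ _

theorem le_maxCommonSuffix (hV : ∀ v ∈ V, v.length = L) {x y : List α} (hx : x ∈ V) (hy : y ∈ V)
    (hxy : x ≠ y) {s : ℕ} (hs : s ≤ L) (h : ∀ t < s, x[L - s + t]? = y[L - s + t]?) :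
    s ≤ maxCommonSuffix V := by
  refine le_csSup (bddAbove_commonSuffix hV) ⟨x, hx, y, hy, hxy, x.drop (L - s),
    List.drop_suffix _ _, ?_, by rw [List.length_drop, hV x hx]; omega⟩
  rw [drop_eq_drop_of_getElem? (hV x hx) (hV y hy) hs h]
  exact List.drop_suffix _ _

end CommonPrefix

theorem prefix_mul_le {n L : ℕ} (hn : 2 ≤ n) (hL : 1 ≤ L) {u v x : List (Fin n)}
    (hu : u.length = L) (huv : u ++ v ∈ threshold n) (hxu : x <+: u)
    (hxv : x <+: v) : ((n : ℝ) - 1) * x.length ≤ L := by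
  refine (mem_threshold_iff hn).1 huv 0 L x.length hL ⟨?_, fun t ht => ?_⟩
  · have := hxv.length_le
    rw [List.length_append, hu]; omega
  · have := hxu.length_le
    rw [zero_add, zero_add, List.getElem?_append_left (by omega),
      List.getElem?_append_right (by omega), hu, Nat.add_sub_cancel_left]
    obtain ⟨a, rfl⟩ := hxu
    obtain ⟨b, rfl⟩ := hxv
    rw [List.getElem?_append_left ht, List.getElem?_append_left ht]

theorem suffix_mul_le {n L : ℕ} (hn : 2 ≤ n) (hL : 1 ≤ L) {u v x : List (Fin n)}
    (hu : u.length = L) (hv : v.length = L) (huv : u ++ v ∈ threshold n) (hxu : x <:+ u)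
    (hxv : x <:+ v) : ((n : ℝ) - 1) * x.length ≤ L := by
  have h1 := hxu.length_le
  refine (mem_threshold_iff hn).1 huv (L - x.length) L x.length hL ⟨?_, fun t ht => ?_⟩
  · rw [List.length_append, hu, hv]; omega
  · rw [List.getElem?_append_left (by omega),
      List.getElem?_append_right (by omega), hu,
      show L - x.length + L + t - L = L - x.length + t by omega]
    obtain ⟨a, rfl⟩ := hxu
    obtain ⟨b, rfl⟩ := hxv
    rw [List.length_append] at hu hv
    rw [List.getElem?_append_right (by omega), List.getElem?_append_right (by omega)]
    congr 1; omega

/-- The set underlying the cyclic substitution is a block code. -/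
theorem CyclicConditions.isBlockCode {n L : ℕ} (hn : 5 ≤ n) {V : Finset (List (Fin n))}
    (hV : 1 < V.card) {J : Fin n → Set (List (Fin n))} (h : CyclicConditions n L V J) :
    IsBlockCode n L (eps V L) (V : Set (List (Fin n))) := by
  have hL : 24 ≤ L := by have := h.length_ge; omega
  have hLr : (24 : ℝ) ≤ L := by exact_mod_cast hL
  have hnr : (5 : ℝ) ≤ n := by exact_mod_cast hn
  refine ⟨hn, by omega, ?_, ?_, Or.inr h.length_ge, h.length_eq, fun v hv =>
    (h.per_eq v hv).trans (h.length_eq v hv), h.pair, fun v _ => Finset.exists_mem_ne hV v⟩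
  · exact div_nonneg (by positivity) (by linarith)
  · obtain ⟨u, hu, v, hv, huv, x, hxu, hxv, hx⟩ := exists_maxCommonPrefix h.length_eq hV
    obtain ⟨u', hu', v', hv', huv', x', hxu', hxv', hx'⟩ :=
      exists_maxCommonSuffix h.length_eq hV
    have h1 := prefix_mul_le (by omega) (by omega) (h.length_eq u hu) (h.pair u hu v hv huv).2
      hxu hxv
    have h2 := suffix_mul_le (by omega) (by omega) (h.length_eq _ hu') (h.length_eq _ hv')
      (h.pair _ hu' _ hv' huv').2 hxu' hxv'
    -- Common prefixes and suffixes have length at most `L / (n - 1) ≤ L / 4`, so their sum is at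
    -- most `L / 2 ≤ L - 1`.
    rw [eps, div_le_one (by linarith), ← hx, ← hx']
    have h3 : (0 : ℝ) ≤ x.length := by positivity
    have h4 : (0 : ℝ) ≤ x'.length := by positivity
    nlinarith

theorem MorphismConditions.isBlockCode {n L : ℕ} (hn : 5 ≤ n) {V : Finset (List (Fin n))}
    (hV : 1 < V.card) (h : MorphismConditions n L V) :
    IsBlockCode n L 0 (V : Set (List (Fin n))) := by
  refine ⟨hn, ?_, le_rfl, zero_le_one, Or.inl rfl, h.length_eq, fun v hv =>
    (h.per_eq v hv).trans (h.length_eq v hv), fun u hu v hv huv => ?_,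
    fun v _ => Finset.exists_mem_ne hV v⟩
  · obtain ⟨u, hu, v, hv, huv⟩ := Finset.one_lt_card.1 hV
    by_contra h0
    apply huv
    rw [List.eq_nil_of_length_eq_zero (l := u) (by rw [h.length_eq u hu]; omega),
      List.eq_nil_of_length_eq_zero (l := v) (by rw [h.length_eq v hv]; omega)]
  · rw [epsThreshold_zero]; exact h.pair u hu v hv huv

theorem cyclicRule_eq {α β : Type*} [DecidableEq α] {im : α → Fin 3 → List β}
    (hinj : Function.Injective (Function.uncurry im)) {u u' : List α} {a a' : α}
    (h : cyclicRule im u a = cyclicRule im u' a') :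
    a = a' ∧ u.count a % 3 = u'.count a' % 3 := by
  have h1 := @hinj (a, ⟨u.count a % 3, _⟩) (a', ⟨u'.count a' % 3, _⟩) h
  exact ⟨congrArg Prod.fst h1, congrArg (fun x => (Prod.snd x).val) h1⟩

theorem subst_replaceRule_cyclic_mem {n L : ℕ} (hn : 5 ≤ n) {V : Finset (List (Fin n))}
    {im : Fin n → Fin 3 → List (Fin n)} {v v' : List (Fin n)}
    (hcard : 1 < V.card) (hinj : Function.Injective (Function.uncurry im))
    (him : ∀ a i, im a i ∈ V) (hv'V : v' ∈ V) (hv' : ∀ a i, v' ≠ im a i)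
    (h : CyclicConditions n L V (imagesWith (fun a => Set.range (im a)) v v'))
    {a : ℕ → Fin n} {m : ℕ} (ha : initialWord a m ∈ epsThreshold n (eps V L)) (S : Set ℕ) :
    subst (replaceRule (cyclicRule im) v v' S) (initialWord a m) ∈
      epsThreshold n (eps V L) := by
  have hC := h.isBlockCode hn hcard
  have h4 := hC.four_le
  have hε := hC.eps_nonneg
  have hmemI : ∀ u b, cyclicRule im u b ∈ Set.range (im b) := fun u b => ⟨_, rfl⟩
  have hruleV : ∀ u b, replaceRule (cyclicRule im) v v' S u b ∈ V := fun u b => by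
    unfold replaceRule
    split_ifs
    · exact hv'V
    · exact him _ _
  have hI : ∀ b c x, x ∈ Set.range (im b) → x ∈ Set.range (im c) → b = c := by
    rintro b c _ ⟨i, rfl⟩ ⟨j, hj⟩
    have := @hinj (c, j) (b, i) hj
    exact (congrArg Prod.fst this).symm
  have hgap : ∀ i j, i < j → j < m → a i = a j → n - 1 ≤ j - i := fun i j hij hj he =>
    le_of_letter_eq (by omega) ha.2 hij hj he
  have hW := isBlockWord_subst (F := replaceRule (cyclicRule im) v v' S)
    (fun u b => h.length_eq _ (hruleV u b)) a m
  rw [mem_epsThreshold_iff (by omega) hC.eps_le]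
  intro i p q hp hr
  rcases hC.admissible_or_alignedRep (fun b c x => imagesWith_disjoint hI fun b ⟨j, hj⟩ =>
      hv' b j hj.symm) h.overlap (a := a) (m := m)
      (fun i j hij hj hjm he => by have := hgap i j hij hjm he; omega)
      (fun c _ => hruleV _ _) (fun c _ => replaceRule_mem_imagesWith hmemI S _ _) hW hp hr with
    h1 | ⟨k, b, d, s, r, rfl, hk, hd, hsL, hrL, -, -, hA⟩
  · exact h1
  have hbd := hA.add_le
  have hrule : ∀ c, b ≤ c → c < b + d → a c = a (c + k) ∧
      (initialWord a c).count (a c) % 3 = (initialWord a (c + k)).count (a c) % 3 := by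
    intro c h1 h2
    have h3 := eq_of_replaceRule_eq (fun u b => hv' _ _) (hA.eq c h1 h2)
    obtain ⟨h5, h6⟩ := cyclicRule_eq hinj h3
    exact ⟨h5, by rw [h6, h5]⟩
  have h3k : 3 * (n - 1) ≤ k := by
    obtain ⟨h1, h2⟩ := hrule b le_rfl (by omega)
    exact three_mul_le_of_count_mod hgap hk (by omega) h1 h2
  have hdk := ((mem_epsThreshold_iff (by omega) hC.eps_le).1 ha b k d hk
    (isRep_initialWord (by omega) fun t ht => by
      rw [(hrule (b + t) (by omega) (by omega)).1]; congr 1; omega)).2 h3k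
  have hs : s ≤ maxCommonSuffix V := by
    rcases hA.suff with rfl | ⟨_, hsL, hne, hs⟩
    · exact Nat.zero_le _
    · exact le_maxCommonSuffix h.length_eq (hruleV _ _) (hruleV _ _) hne hsL hs
  have hr' : r ≤ maxCommonPrefix V := by
    rcases hA.pref with rfl | ⟨_, hrL, hne, hr⟩
    · exact Nat.zero_le _
    · exact le_maxCommonPrefix h.length_eq (hruleV _ _) (hruleV _ _) hne hrL hr
  have hL : (1 : ℝ) < L := by
    have := h.length_ge
    exact_mod_cast (by omega : 1 < L)
  have heps : eps V L * ((L : ℝ) - 1) = maxCommonPrefix V + maxCommonSuffix V := by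
    rw [eps, div_mul_cancel₀ _ (by linarith)]
  have hs : (s : ℝ) ≤ maxCommonSuffix V := by exact_mod_cast hs
  have hr' : (r : ℝ) ≤ maxCommonPrefix V := by exact_mod_cast hr'
  have hq : (q : ℝ) ≤ s + d * L + r := by exact_mod_cast hA.le
  have hfin : ((n : ℝ) - 1) * (q + eps V L) ≤ ((k * L : ℕ) : ℝ) := by
    -- By the choice of `ε`, `s + r ≤ ε * (L - 1)`. Thus the bound for `(d, k)` in the preimage,
    -- multiplied by `L`, is the bound for the image, with the same `ε`.
    have h1 : (q : ℝ) + eps V L ≤ (d + eps V L) * L := by nlinarith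
    push_cast
    calc ((n : ℝ) - 1) * (q + eps V L) ≤ ((n : ℝ) - 1) * ((d + eps V L) * L) :=
          mul_le_mul_of_nonneg_left h1 (by linarith)
      _ = ((n : ℝ) - 1) * (d + eps V L) * L := by ring
      _ ≤ k * L := mul_le_mul_of_nonneg_right hdk (by linarith)
  exact ⟨by nlinarith, fun _ => hfin⟩

/-! ### Letters of threshold words, and images under the morphism -/

/-- The threshold condition on words given by their letters, in natural numbers. -/
theorem mul_le_of_letters_eq {M : ℕ} (hM : 2 ≤ M) {a : ℕ → Fin M} {m : ℕ}
    (ha : initialWord a m ∈ threshold M) {i p q : ℕ} (hp : 1 ≤ p) (hm : i + p + q ≤ m)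
    (h : ∀ t < q, a (i + t) = a (i + p + t)) : (M - 1) * q ≤ p := by
  have := (mem_threshold_iff hM).1 ha i p q hp (isRep_initialWord hm h)
  rw [← Nat.cast_le (α := ℝ), Nat.cast_mul, Nat.cast_sub (by omega)]
  exact_mod_cast this

/-- If `M - 1` consecutive letters of a threshold word avoid the letter `x`, then all
other letters are among them. -/
theorem exists_letter_eq {M : ℕ} (hM : 2 ≤ M) {a : ℕ → Fin M} {m : ℕ}
    (ha : initialWord a m ∈ threshold M) {c : ℕ} (hc : c + (M - 1) ≤ m) {x y : Fin M}
    (hx : ∀ j < M - 1, a (c + j) ≠ x) (hy : y ≠ x) : ∃ j < M - 1, a (c + j) = y := by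
  have hinj : Set.InjOn (fun j => a (c + j)) (Finset.range (M - 1) : Set ℕ) := by
    intro i hi j hj he
    simp only [Finset.coe_range, Set.mem_Iio] at hi hj
    by_contra hne
    rcases Nat.lt_or_gt_of_ne hne with hlt | hlt
    · have := le_of_letter_eq hM ha (i := c + i) (j := c + j) (by omega) (by omega) he
      omega
    · have := le_of_letter_eq hM ha (i := c + j) (j := c + i) (by omega) (by omega) he.symm
      omega
  have hcard := Finset.card_image_of_injOn hinj
  have hnot : x ∉ (Finset.range (M - 1)).image (fun j => a (c + j)) := by
    rw [Finset.mem_image]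
    rintro ⟨j, hj, he⟩
    exact hx j (Finset.mem_range.1 hj) he
  have huniv : insert x ((Finset.range (M - 1)).image fun j => a (c + j)) = Finset.univ := by
    apply Finset.eq_univ_of_card
    rw [Finset.card_insert_of_notMem hnot, hcard, Finset.card_range, Fintype.card_fin]
    omega
  have hmem : y ∈ insert x ((Finset.range (M - 1)).image fun j => a (c + j)) := by
    rw [huniv]; exact Finset.mem_univ y
  rcases Finset.mem_insert.1 hmem with h | h
  · exact absurd h hy
  · obtain ⟨j, hj, he⟩ := Finset.mem_image.1 h
    exact ⟨j, Finset.mem_range.1 hj, he⟩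

/-- Every letter occurs among any `M + 1` consecutive letters of a threshold word over `M`
letters. -/
theorem exists_letter_window {M : ℕ} (hM : 2 ≤ M) {a : ℕ → Fin M} {m : ℕ}
    (ha : initialWord a m ∈ threshold M) {c : ℕ} (hc : c + (M + 1) ≤ m) (x : Fin M) :
    ∃ t, c ≤ t ∧ t < c + (M + 1) ∧ a t = x := by
  by_contra hno
  push Not at hno
  -- If `x` is missing, every window of `M - 1` letters here contains all other letters. So the next
  -- letter repeats the first of the window; two consecutive windows give a repetition of period `M
  -- - 1` with two repeated letters, which is too long.
  obtain ⟨j, hj, he⟩ := exists_letter_eq hM ha (c := c) (by omega)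
    (fun j hj => hno _ (by omega) (by omega)) (hno (c + (M - 1)) (by omega) (by omega))
  obtain ⟨j', hj', he'⟩ := exists_letter_eq hM ha (c := c + 1) (by omega)
    (fun j hj => hno _ (by omega) (by omega)) (hno (c + M) (by omega) (by omega))
  have h1 := le_of_letter_eq hM ha (i := c + j) (by omega) (by omega) he
  have h2 := le_of_letter_eq hM ha (i := c + 1 + j') (by omega) (by omega) he'
  obtain rfl : j = 0 := by omega
  obtain rfl : j' = 0 := by omega
  have := mul_le_of_letters_eq hM ha (i := c) (p := M - 1) (q := 2) (by omega) (by omega)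
    fun t ht => by
      rcases (by omega : t = 0 ∨ t = 1) with rfl | rfl
      · exact he
      · rw [show c + (M - 1) + 1 = c + M by omega]; exact he'
  omega

/-- Around a repetition of a single letter at the distance `M` in a threshold word over `M`
letters, the letters before the first and after the second occurrence agree. -/
theorem letter_eq_of_return {M : ℕ} (hM : 4 ≤ M) {a : ℕ → Fin M} {m : ℕ}
    (ha : initialWord a m ∈ threshold M) {c : ℕ} (hc : c + M + 1 < m)
    (h : a (c + 1) = a (c + M)) : a c ≠ a (c + (M - 1)) ∧ a (c + 2) ≠ a (c + M + 1) ∧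
      a (c + M + 1) = a c := by
  have hM2 : 2 ≤ M := by omega
  have h0 : a c ≠ a (c + (M - 1)) := fun he => by
    have := mul_le_of_letters_eq hM2 ha (i := c) (p := M - 1) (q := 2) (by omega) (by omega)
      fun t ht => by
        rcases (by omega : t = 0 ∨ t = 1) with rfl | rfl
        · exact he
        · rw [show c + (M - 1) + 1 = c + M by omega]; exact h
    omega
  have h2 : a (c + 2) ≠ a (c + M + 1) := fun he => by
    have := mul_le_of_letters_eq hM2 ha (i := c + 1) (p := M - 1) (q := 2) (by omega) (by omega)
      fun t ht => by
        rcases (by omega : t = 0 ∨ t = 1) with rfl | rfl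
        · rw [show c + 1 + (M - 1) + 0 = c + M by omega]; exact h
        · rw [show c + 1 + (M - 1) + 1 = c + M + 1 by omega]; exact he
    omega
  refine ⟨h0, h2, ?_⟩
  by_contra hne
  have hfar : ∀ j, 0 < j → j ≤ M → a (c + j) ≠ a (c + M + 1) := by
    intro j hj hjM he
    have := le_of_letter_eq hM2 ha (i := c + j) (by omega) hc he
    rcases (by omega : j = 1 ∨ j = 2) with rfl | rfl
    · have := le_of_letter_eq hM2 ha (i := c + M) (j := c + M + 1) (by omega) hc
        (h.symm.trans he)
      omega
    · exact h2 he
  -- The `M - 1` letters from `c` on avoid `a (c + (M - 1))`, hence contain `a (c + M + 1)`. By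
  -- `hfar` only position `c` remains for it.
  obtain ⟨j, hj, he⟩ := exists_letter_eq hM2 ha (c := c) (by omega) (x := a (c + (M - 1)))
    (fun j hj he => by
      rcases Nat.eq_zero_or_pos j with rfl | hj0
      · exact h0 he
      · have := le_of_letter_eq hM2 ha (i := c + j) (j := c + (M - 1)) (by omega) (by omega) he
        omega)
    (hfar (M - 1) (by omega) (by omega)).symm
  rcases Nat.eq_zero_or_pos j with rfl | hj0
  · exact hne he.symm
  · exact hfar j hj0 (by omega) he



theorem subst_replaceRule_morphism_mem {n k₀ L : ℕ} (hn : 5 ≤ n) (hk₀ : 1 ≤ k₀)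
    {V : Finset (List (Fin n))} {f : Fin (n + k₀) → List (Fin n)} {v v' : List (Fin n)}
    (hcard : 1 < V.card) (hinj : Function.Injective f)
    (hf : ∀ a, f a ∈ V) (hv'V : v' ∈ V) (hv' : ∀ a, v' ≠ f a)
    (h : MorphismConditions n L V)
    (hO : OverlapCondition n L 0 V (imagesWith (fun a => {f a}) v v'))
    {a : ℕ → Fin (n + k₀)} {m : ℕ} (ha : initialWord a m ∈ threshold (n + k₀)) (S : Set ℕ) :
    subst (replaceRule (morphismRule f) v v' S) (initialWord a m) ∈ threshold n := by
  have hC := h.isBlockCode hn hcard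
  have h4 := hC.four_le
  have hruleV : ∀ u b, replaceRule (morphismRule f) v v' S u b ∈ V := fun u b => by
    unfold replaceRule
    split_ifs
    · exact hv'V
    · exact hf _
  have hJ : ∀ b c x, x ∈ imagesWith (fun a => {f a}) v v' b →
      x ∈ imagesWith (fun a => {f a}) v v' c → b = c := fun b c x =>
    imagesWith_disjoint (fun b c x hb hc => hinj ((Set.mem_singleton_iff.1 hb).symm.trans
      (Set.mem_singleton_iff.1 hc))) (fun b hb => hv' b (Set.mem_singleton_iff.1 hb))
  have hBJ : ∀ u b, replaceRule (morphismRule f) v v' S u b ∈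
      imagesWith (fun a => {f a}) v v' b := fun u b =>
    replaceRule_mem_imagesWith (F := morphismRule f) (I := fun a => {f a})
      (fun u b => Set.mem_singleton _) S u b
  have hgap : ∀ i j, i < j → j < m → a i = a j → n + k₀ - 1 ≤ j - i := fun i j hij hj he =>
    le_of_letter_eq (by omega) ha hij hj he
  have hW := isBlockWord_subst (F := replaceRule (morphismRule f) v v' S)
    (fun u b => h.length_eq _ (hruleV u b)) a m
  rw [← epsThreshold_zero, mem_epsThreshold_iff (by omega) hC.eps_le]
  intro i p q hp hr
  rcases hC.admissible_or_alignedRep hJ hO (a := a) (m := m)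
      (fun i j hij hj hjm he => by have := hgap i j hij hjm he; omega)
      (fun c _ => hruleV _ _) (fun c _ => hBJ _ _) hW hp hr with
    h1 | ⟨k, b, d, s, r, rfl, hk, hd, hsL, hrL, hs, hr', hA⟩
  · exact h1
  suffices hfin : ((n : ℝ) - 1) * q ≤ ((k * L : ℕ) : ℝ) from
    ⟨hfin, fun _ => by rwa [add_zero]⟩
  have hbd := hA.add_le
  have hlet : ∀ c, b ≤ c → c < b + d → a c = a (c + k) := by
    intro c h1 h2
    exact hinj (eq_of_replaceRule_eq (fun u b => hv' _) (hA.eq c h1 h2))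
  have hdk : (n + k₀ - 1) * d ≤ k := mul_le_of_letters_eq (by omega) ha (i := b) hk (by omega)
    fun t ht => by rw [hlet (b + t) (by omega) (by omega)]; congr 1; omega
  have hq : (q : ℝ) ≤ s + d * L + r := by exact_mod_cast hA.le
  rw [add_zero] at hs hr'
  have hL0 : (0 : ℝ) ≤ L := by positivity
  have hqn : ((n : ℝ) - 1) * q ≤ ((n : ℝ) - 1) * s + ((n : ℝ) - 1) * d * L
      + ((n : ℝ) - 1) * r := by nlinarith
  obtain ⟨n', hn'⟩ : ∃ n', n = n' + 1 := ⟨n - 1, by omega⟩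
  have hcast : (n : ℝ) - 1 = n' := by rw [hn']; push_cast; ring
  -- The suffix and the prefix each cost at most `L` after multiplication by `n - 1`, so two spare
  -- units in `k` pay for both. Otherwise `(n + k₀ - 1) * d ≤ k` leaves only `k₀ = d = 1` and `k =
  -- n`.
  by_cases hbig : n' * d + 2 ≤ k
  · have : ((n' * d + 2 : ℕ) : ℝ) * L ≤ (k : ℝ) * L :=
      mul_le_mul_of_nonneg_right (by exact_mod_cast hbig) hL0
    rw [hcast] at hs hr' hqn ⊢
    push_cast at this ⊢
    linarith
  have hmul : (n + k₀ - 1) * d = n' * d + k₀ * d := by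
    rw [← Nat.add_mul]; congr 1; omega
  have hone : k₀ * d = 1 := by
    have := Nat.mul_pos hk₀ hd
    omega
  obtain ⟨rfl, rfl⟩ := mul_eq_one.1 hone
  obtain rfl : k = n := by omega
  suffices hsr : ((k : ℝ) - 1) * s + ((k : ℝ) - 1) * r ≤ L by
    push_cast at hqn ⊢
    linarith
  rcases hA.suff with rfl | ⟨hb, -, hne, hs'⟩
  · simpa using hr'
  rcases hA.pref with rfl | ⟨hbm, -, hne', hr''⟩
  · simpa using hs
  obtain ⟨c, rfl⟩ := Nat.exists_eq_add_of_le' hb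
  simp only [Nat.add_sub_cancel] at hne hs'
  obtain ⟨g0, g2, g1⟩ := letter_eq_of_return (M := k + 1) (by omega) ha (c := c) (by omega)
    (by rw [hlet (c + 1) le_rfl (by omega)]; congr 1; omega)
  rw [Nat.add_sub_cancel] at g0
  set B : ℕ → List (Fin k) := fun c =>
    replaceRule (morphismRule f) v v' S (initialWord a c) (a c) with hB
  have hBV : ∀ c, B c ∈ V := fun c => hruleV _ _
  have hBa : ∀ c, B c ∈ imagesWith (fun a => {f a}) v v' (a c) := fun c => hBJ _ _
  have hnot : ∀ j, a j ≠ a c → B j ∉ imagesWith (fun a => {f a}) v v' (a c) :=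
    fun j hj hmem => hj (hJ _ _ _ (hBa j) hmem)
  have hlast : B (c + 1 + 1 + k) ∈ imagesWith (fun a => {f a}) v v' (a c) := by
    rw [← g1, show c + (k + 1) + 1 = c + 1 + 1 + k by omega]; exact hBa _
  -- The blocks before the first and after the second copy of the repeated block belong to the same
  -- letter `a c`, though one of them may have been replaced. This is the case for which the overlap
  -- condition admits two images `x`, `x'`.
  have hO' := hO (a c) (B (c + 1 + 1)) (hBV _)
    (hnot _ fun he => by have := hgap c (c + 1 + 1) (by omega) (by omega) he.symm; omega)
    (B (c + k)) (hBV _) (hnot _ g0.symm)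
    (fun he => by
      have h5 := hJ _ _ _ (hBa (c + 1 + 1)) (he ▸ hBa (c + k))
      have := hgap (c + 1 + 1) (c + k) (by omega) (by omega) h5
      omega)
    (B (c + 1 + 1 + k)) hlast (B c) (hBa c)
    ((B (c + 1 + 1)).take r) ((B c).drop (L - s)) (List.take_prefix _ _)
    (by rw [take_eq_take_of_getElem? hr'']; exact List.take_prefix _ _)
    (List.drop_suffix _ _)
    (by
      rw [drop_eq_drop_of_getElem? (h.length_eq _ (hBV c)) (h.length_eq _ (hBV _)) hsL hs']
      exact List.drop_suffix _ _)
  rw [List.length_take, List.length_drop, h.length_eq _ (hBV _),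
    h.length_eq _ (hBV c), min_eq_left hrL, show L - (L - s) = s by omega,
    le_div_iff₀ (by linarith)] at hO'
  linarith



/-! ### Branching and growth of the replacement tree -/

theorem initialWord_prefix {α : Type*} (a : ℕ → α) {m m' : ℕ} (h : m ≤ m') :
    initialWord a m <+: initialWord a m' := by
  obtain ⟨d, rfl⟩ := Nat.exists_eq_add_of_le h
  induction d with
  | zero => exact List.prefix_rfl
  | succ d ih =>
    rw [← add_assoc, initialWord_succ]
    exact (ih (by omega)).trans (List.prefix_append _ _)

theorem eq_initialWord_of_prefix {α : Type*} {a : ℕ → α} {m : ℕ} {x : List α}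
    (h : x <+: initialWord a m) : x = initialWord a x.length := by
  have hle := h.length_le
  rw [initialWord_length] at hle
  exact (List.prefix_of_prefix_length_le h (initialWord_prefix a hle)
    (by rw [initialWord_length])).eq_of_length (by rw [initialWord_length])

theorem initialWord_congr {α : Type*} {a b : ℕ → α} {m : ℕ} :
    initialWord a m = initialWord b m ↔ ∀ j < m, a j = b j := by
  simp [initialWord, List.map_inj_left]

/-- A family of infinite words divided into blocks of length `L`: the blocks with index `c ∈ P`
have two versions, chosen according to whether `c ∈ S`, which differ for the first time
at offset `δ`. -/
structure IsBinaryChoice {β : Type*} (L δ : ℕ) (P : Set ℕ) (y : Set ℕ → ℕ → β) : Prop where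
  lt : δ < L
  congr : ∀ S S' c r, r < L → (c ∈ S ↔ c ∈ S') → y S (c * L + r) = y S' (c * L + r)
  const : ∀ S S' c r, r < L → c ∉ P ∨ r < δ → y S (c * L + r) = y S' (c * L + r)
  ne : ∀ S S', ∀ c ∈ P, c ∈ S → c ∉ S' → y S (c * L + δ) ≠ y S' (c * L + δ)

/-- The tree of the prefixes of a family of infinite words. -/
def prefixTree {ι β : Type*} (y : ι → ℕ → β) : Set (List β) :=
  {x | ∃ S m, x = initialWord (y S) m}

namespace IsBinaryChoice

variable {β : Type*} {L δ : ℕ} {P : Set ℕ} {y : Set ℕ → ℕ → β}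

theorem length_of_isBranching (h : IsBinaryChoice L δ P y) {x : List β}
    (hx : IsBranching (prefixTree y) x) : ∃ c ∈ P, x.length = c * L + δ := by
  obtain ⟨e, e', hne, ⟨S, m, hS⟩, ⟨S', m', hS'⟩⟩ := hx
  have hlen := congrArg List.length hS
  have hlen' := congrArg List.length hS'
  rw [initialWord_length, List.length_append, List.length_singleton] at hlen hlen'
  subst hlen hlen'
  rw [initialWord_succ] at hS hS'
  obtain ⟨hx, he⟩ := List.append_inj' hS rfl
  obtain ⟨hx', he'⟩ := List.append_inj' hS' rfl
  have hy : y S x.length ≠ y S' x.length := by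
    rw [List.singleton_inj] at he he'
    rwa [← he, ← he']
  have hag := initialWord_congr.1 (hx.symm.trans hx')
  have hL : 0 < L := by have := h.lt; omega
  obtain ⟨c, r, hr, hm⟩ : ∃ c r, r < L ∧ x.length = c * L + r :=
    ⟨_, _, Nat.mod_lt _ hL, (Nat.div_add_mod' _ L).symm⟩
  rw [hm] at hy hag
  have hc : ¬ (c ∉ P ∨ r < δ) := fun h1 => hy (h.const S S' c r hr h1)
  push Not at hc
  have hcS : ¬ (c ∈ S ↔ c ∈ S') := fun h1 => hy (h.congr S S' c r hr h1)
  refine ⟨c, hc.1, ?_⟩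
  rw [hm]
  -- Past offset `δ` the two words would already have differed at `c * L + δ`, although they agree
  -- up to the branching vertex.
  by_contra hrδ
  have hag := hag (c * L + δ) (by omega)
  by_cases h1 : c ∈ S
  · exact h.ne S S' c hc.1 h1 (fun h2 => hcS ⟨fun _ => h2, fun _ => h1⟩) hag
  · exact h.ne S' S c hc.1 (by tauto) h1 hag.symm

theorem isBranching (h : IsBinaryChoice L δ P y) (S : Set ℕ) {c : ℕ} (hc : c ∈ P) :
    IsBranching (prefixTree y) (initialWord (y S) (c * L + δ)) := by
  have hL : 0 < L := by have := h.lt; omega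
  have key : ∀ S' : Set ℕ, (∀ b, b ≠ c → (b ∈ S ↔ b ∈ S')) →
      initialWord (y S) (c * L + δ) ++ [y S' (c * L + δ)] ∈ prefixTree y := by
    intro S' hS'
    refine ⟨S', c * L + δ + 1, ?_⟩
    rw [initialWord_succ, List.append_left_inj, initialWord_congr]
    intro j hj
    obtain ⟨b, r, hr, rfl⟩ : ∃ b r, r < L ∧ j = b * L + r :=
      ⟨_, _, Nat.mod_lt _ hL, (Nat.div_add_mod' _ L).symm⟩
    by_cases hb : b = c
    · subst hb
      exact h.const S S' b r hr (Or.inr (by omega))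
    · exact h.congr S S' b r hr (hS' b hb)
  exact ⟨_, _, h.ne (insert c S) (S \ {c}) c hc (Set.mem_insert _ _) (by simp),
    key _ fun b hb => by simp [hb], key _ fun b hb => by simp [hb]⟩

theorem uniformlyGrowing [Finite β] (h : IsBinaryChoice L δ P y) {lo H : ℕ}
    (hlo : ∀ c ∈ P, ∀ c' ∈ P, c < c' → lo ≤ c' - c)
    (hH : ∀ c, ∃ p ∈ P, c ≤ p ∧ p < c + H) :
    UniformlyGrowing (prefixTree y) (lo * L) (H * L) := by
  have hL : 0 < L := by have := h.lt; omega
  have hlt : ∀ c c', c < c' → c * L + L ≤ c' * L := fun c c' hc => by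
    rw [← Nat.succ_mul]; exact Nat.mul_le_mul_right L hc
  refine ⟨?_, ?_, ?_⟩
  · rintro _ ⟨S, m, rfl⟩
    obtain ⟨c, r, hr, rfl⟩ : ∃ c r, r < L ∧ m = c * L + r :=
      ⟨_, _, Nat.mod_lt _ hL, (Nat.div_add_mod' _ L).symm⟩
    have hδ := h.lt
    -- If the choice offset of the current block has been passed, the search starts at the next
    -- block; otherwise the current block may serve. This keeps the distance strictly below `H * L`.
    rcases Nat.lt_or_ge δ r with hrδ | hrδ
    · obtain ⟨p, hp, h1, h2⟩ := hH (c + 1)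
      have h3 := hlt c p h1
      have h4 := hlt p (c + 1 + H) h2
      rw [Nat.add_mul, Nat.add_mul] at h4
      refine ⟨_, h.isBranching S hp, initialWord_prefix _ (by omega), ?_⟩
      rw [initialWord_length, initialWord_length]; omega
    · obtain ⟨p, hp, h1, h2⟩ := hH c
      have h3 := Nat.mul_le_mul_right L h1
      have h4 := hlt p (c + H) h2
      rw [Nat.add_mul] at h4
      refine ⟨_, h.isBranching S hp, initialWord_prefix _ (by omega), ?_⟩
      rw [initialWord_length, initialWord_length]; omega
  · rintro x z ⟨hx, hz, hxz, hne, hbetween⟩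
    obtain ⟨c, hc, hxl⟩ := h.length_of_isBranching hx
    obtain ⟨c', hc', hzl⟩ := h.length_of_isBranching hz
    have hcc' : c < c' := by
      by_contra hcon
      have := Nat.mul_le_mul_right L (not_lt.1 hcon)
      exact hne (hxz.eq_of_length_le (by omega))
    constructor
    · have := Nat.mul_le_mul_right L (hlo c hc c' hc' hcc')
      rw [Nat.sub_mul] at this
      have := hlt c c' hcc'
      omega
    · obtain ⟨p, hp, h1, h2⟩ := hH (c + 1)
      have h5 := Nat.mul_le_mul_right L (show p ≤ c + H by omega)
      rw [Nat.add_mul] at h5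
      by_cases hpc : p < c'
      · exfalso
        have h3 := hlt c p h1
        have h4 := hlt p c' hpc
        obtain ⟨e, e', -, ⟨S, m, hS⟩, -⟩ := hz
        have hzS : z = initialWord (y S) z.length :=
          eq_initialWord_of_prefix (hS ▸ List.prefix_append z [e])
        have hpz : initialWord (y S) (p * L + δ) <+: z := by
          rw [hzS]; exact initialWord_prefix _ (by omega)
        rcases hbetween _ (h.isBranching S hp) (List.prefix_of_prefix_length_le hxz hpz
          (by rw [initialWord_length]; omega)) hpz with h6 | h6
        · have := congrArg List.length h6
          rw [initialWord_length] at this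
          omega
        · have := congrArg List.length h6
          rw [initialWord_length] at this
          omega
      · have := Nat.mul_le_mul_right L (not_lt.1 hpc)
        omega
  · intro m
    -- One choice block is picked in each window of `H` blocks. The first `m` letters contain `k`
    -- complete windows, and the `2 ^ k` subsets of these choices give different prefixes of length
    -- `m`.
    choose p hpP hp1 hp2 using fun i => hH (i * H)
    have hpi : Function.Injective p := by
      refine StrictMono.injective (strictMono_nat_of_lt_succ fun i => ?_)
      have := hp1 (i + 1)
      rw [Nat.succ_mul] at this
      exact (hp2 i).trans_le this
    set k := m / (H * L) with hk
    have hkm : k * H * L ≤ m := by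
      rw [mul_assoc]; exact Nat.div_mul_le_self m (H * L)
    have hinj : Set.InjOn (fun A : Finset ℕ => initialWord (y (p '' (A : Set ℕ))) m)
        ((Finset.range k).powerset : Set (Finset ℕ)) := by
      have key : ∀ A B : Finset ℕ, A ⊆ Finset.range k →
          initialWord (y (p '' (A : Set ℕ))) m = initialWord (y (p '' (B : Set ℕ))) m →
          A ⊆ B := by
        intro A B hA he i hi
        by_contra hiB
        have hik := Finset.mem_range.1 (hA hi)
        have h1 := hp2 i
        have h2 := Nat.mul_le_mul_right H (show i + 1 ≤ k from hik)
        rw [Nat.add_mul, one_mul] at h2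
        have h3 := hlt (p i) (k * H) (by omega)
        have hδ := h.lt
        have hin : p i ∈ p '' (A : Set ℕ) := Set.mem_image_of_mem p hi
        have hout : p i ∉ p '' (B : Set ℕ) := by
          rintro ⟨j, hj, hji⟩
          exact hiB (hpi hji ▸ hj)
        exact h.ne _ _ (p i) (hpP i) hin hout (initialWord_congr.1 he _ (by omega))
      intro A hA B hB he
      exact Finset.Subset.antisymm (key A B (Finset.mem_powerset.1 hA) he)
        (key B A (Finset.mem_powerset.1 hB) he.symm)
    have hcard := hinj.ncard_image
    rw [Set.ncard_coe_finset, Finset.card_powerset, Finset.card_range] at hcard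
    rw [← hcard]
    refine Set.ncard_le_ncard ?_ ((List.finite_length_eq β m).subset fun x hx => hx.2)
    rintro _ ⟨A, -, rfl⟩
    exact ⟨⟨_, m, rfl⟩, initialWord_length _ _⟩

end IsBinaryChoice

theorem IsBlockWord.eq_initialWord {α : Type*} [Inhabited α] {L m : ℕ} (hL : 0 < L)
    {B : ℕ → List α} {W : List α} (hW : IsBlockWord L m B W) :
    W = initialWord (fun j => ((B (j / L))[j % L]?).getD default) (m * L) := by
  refine List.ext_getElem? fun j => ?_
  rcases Nat.lt_or_ge j (m * L) with hj | hj
  · have hjL := Nat.mod_lt j hL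
    rw [initialWord_getElem? _ hj, ← hW.2 (j / L) ((Nat.div_lt_iff_lt_mul hL).2 hj) (j % L) hjL,
      Nat.div_add_mod', List.getElem?_eq_getElem (by rwa [hW.1])]
    rfl
  · rw [List.getElem?_eq_none (by rwa [hW.1]),
      List.getElem?_eq_none (by rwa [initialWord_length])]

/-- The letters of the infinite image of `ω` under the rule `F`. -/
def imageLetter {α β : Type*} [Inhabited β] (F : List α → α → List β) (L : ℕ) (ω : ℕ → α)
    (j : ℕ) : β :=
  ((F (initialWord ω (j / L)) (ω (j / L)))[j % L]?).getD default

theorem replaceRule_length {α β : Type*} {F : List α → α → List β} {v v' : List β} {L : ℕ}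
    (hF : ∀ u a, (F u a).length = L) (hv' : v'.length = L) (S : Set ℕ) (u : List α) (a : α) :
    (replaceRule F v v' S u a).length = L := by
  unfold replaceRule
  split_ifs
  · exact hv'
  · exact hF u a

/-- The finite images for a fixed `S` are the beginnings of one infinite word, since replacement
depends only on positions in the preimage. The tree thus becomes a family of infinite words indexed
by `S`. -/
theorem replacementTree_eq {α β : Type*} [Inhabited β] {F : List α → α → List β}
    {v v' : List β} {L : ℕ} (hL : 0 < L) (hF : ∀ u a, (F u a).length = L)
    (hv' : v'.length = L) (ω : ℕ → α) :
    replacementTree F v v' ω =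
      prefixTree fun S : Set ℕ => imageLetter (replaceRule F v v' S) L ω := by
  have hW : ∀ S m, subst (replaceRule F v v' S) (initialWord ω m) =
      initialWord (imageLetter (replaceRule F v v' S) L ω) (m * L) := fun S m =>
    (isBlockWord_subst (replaceRule_length hF hv' S) ω m).eq_initialWord hL
  ext x
  constructor
  · rintro ⟨S, m, hx⟩
    rw [hW] at hx
    exact ⟨S, _, eq_initialWord_of_prefix hx⟩
  · rintro ⟨S, m, rfl⟩
    exact ⟨S, m, by rw [hW]; exact initialWord_prefix _ (Nat.le_mul_of_pos_right m hL)⟩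

theorem imageLetter_block {α β : Type*} [Inhabited β] (F : List α → α → List β) {L : ℕ}
    (ω : ℕ → α) (c : ℕ) {r : ℕ} (hr : r < L) :
    imageLetter F L ω (c * L + r) = ((F (initialWord ω c) (ω c))[r]?).getD default := by
  have h1 : (c * L + r) / L = c := by
    rw [mul_comm, Nat.mul_add_div (by omega), Nat.div_eq_of_lt hr, add_zero]
  have h2 : (c * L + r) % L = r := by
    rw [mul_comm, Nat.mul_add_mod, Nat.mod_eq_of_lt hr]
  rw [imageLetter, h1, h2]

theorem replaceRule_initialWord {α β : Type*} {F : List α → α → List β} {v v' : List β}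
    {S : Set ℕ} {ω : ℕ → α} {c : ℕ} (hF : F (initialWord ω c) (ω c) = v) (hc : c ∈ S) :
    replaceRule F v v' S (initialWord ω c) (ω c) = v' := by
  rw [replaceRule, if_pos ⟨hF, by rwa [initialWord_length]⟩]

theorem replaceRule_initialWord_of_notMem {α β : Type*} {F : List α → α → List β}
    {v v' : List β} {S : Set ℕ} {ω : ℕ → α} {c : ℕ} (hc : c ∉ S) :
    replaceRule F v v' S (initialWord ω c) (ω c) = F (initialWord ω c) (ω c) := by
  rw [replaceRule, if_neg]
  rintro ⟨-, h⟩
  rw [initialWord_length] at h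
  exact hc h

/-- `δ` is the first position at which `v` and `v'` differ; it is below `L` because both have length
`L`. -/
theorem exists_isBinaryChoice {α β : Type*} [Inhabited β] {F : List α → α → List β}
    {v v' : List β} {L : ℕ} (hvL : v.length = L) (hv' : v'.length = L)
    (hvv' : v ≠ v') (ω : ℕ → α) :
    ∃ δ, IsBinaryChoice L δ {c | F (initialWord ω c) (ω c) = v}
      fun S : Set ℕ => imageLetter (replaceRule F v v' S) L ω := by
  classical
  have hex : ∃ d : ℕ, v[d]? ≠ v'[d]? := by
    by_contra hno
    push Not at hno
    exact hvv' (List.ext_getElem? hno)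
  have hδ := Nat.find_spec hex
  have hmin : ∀ t < Nat.find hex, v[t]? = v'[t]? := fun t ht => by
    simpa using Nat.find_min hex ht
  generalize Nat.find hex = δ at hδ hmin
  have hδL : δ < L := by
    by_contra hcon
    exact hδ (by rw [List.getElem?_eq_none (by omega), List.getElem?_eq_none (by omega)])
  refine ⟨δ, hδL, fun S S' c r hr hc => ?_, fun S S' c r hr hc => ?_, fun S S' c hc h1 h2 => ?_⟩
  · simp only [imageLetter_block _ _ _ hr]
    by_cases h1 : F (initialWord ω c) (ω c) = v
    · by_cases h2 : c ∈ S
      · rw [replaceRule_initialWord h1 h2, replaceRule_initialWord h1 (hc.1 h2)]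
      · rw [replaceRule_initialWord_of_notMem h2,
          replaceRule_initialWord_of_notMem fun h3 => h2 (hc.2 h3)]
    · simp only [replaceRule, h1, false_and, if_false]
  · simp only [imageLetter_block _ _ _ hr]
    by_cases h1 : F (initialWord ω c) (ω c) = v
    · have hr' : r < δ := hc.resolve_left fun h2 => h2 h1
      have key : ∀ S, (replaceRule F v v' S (initialWord ω c) (ω c))[r]? = v[r]? := fun S => by
        by_cases h2 : c ∈ S
        · rw [replaceRule_initialWord h1 h2, hmin r hr']
        · rw [replaceRule_initialWord_of_notMem h2, h1]
      rw [key, key]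
    · simp only [replaceRule, h1, false_and, if_false]
  · have hc : F (initialWord ω c) (ω c) = v := hc
    simp only [imageLetter_block _ _ _ hδL]
    rw [replaceRule_initialWord hc h1, replaceRule_initialWord_of_notMem h2, hc,
      List.getElem?_eq_getElem (by omega), List.getElem?_eq_getElem (by omega)]
    rw [List.getElem?_eq_getElem (by omega), List.getElem?_eq_getElem (by omega)] at hδ
    exact fun he => hδ (congrArg some he.symm)

/-- The replacement tree grows uniformly if the occurrences of `v` do. -/
theorem uniformlyGrowing_replacementTree {α β : Type*} [Inhabited β] [Finite β]
    {F : List α → α → List β} {v v' : List β} {L : ℕ} (hF : ∀ u a, (F u a).length = L)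
    (hvL : v.length = L) (hv' : v'.length = L) (hvv' : v ≠ v') {ω : ℕ → α} {lo H : ℕ}
    (hlo : ∀ c c', F (initialWord ω c) (ω c) = v → F (initialWord ω c') (ω c') = v → c < c' →
      lo ≤ c' - c)
    (hH : ∀ c, ∃ p, F (initialWord ω p) (ω p) = v ∧ c ≤ p ∧ p < c + H) :
    UniformlyGrowing (replacementTree F v v' ω) (lo * L) (H * L) := by
  obtain ⟨δ, hδ⟩ := exists_isBinaryChoice (F := F) hvL hv' hvv' ω
  rw [replacementTree_eq (by have := hδ.lt; omega) hF hv']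
  exact hδ.uniformlyGrowing (fun c hc c' hc' => hlo c c' hc hc') hH



/-! ### Recurrence of the replaceable image, and the theorem -/

/-- In the cyclic substitution every image of a letter occurs in any window of `3 * M + 3`
blocks. -/
theorem exists_cyclicRule_eq {M : ℕ} (hM : 2 ≤ M) {β : Type*} {ω : ℕ → Fin M}
    (hω : ∀ m, initialWord ω m ∈ threshold M) (im : Fin M → Fin 3 → List β) (b : Fin M)
    (i : Fin 3) (c : ℕ) :
    ∃ p, cyclicRule im (initialWord ω p) (ω p) = im b i ∧ c ≤ p ∧ p < c + (3 * M + 3) := by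
  have step : ∀ c, (initialWord ω c).count b + 1 ≤ (initialWord ω (c + (M + 1))).count b := by
    intro c
    obtain ⟨t, h1, h2, h3⟩ := exists_letter_window hM (hω (c + (M + 1))) le_rfl b
    have h4 := count_initialWord_mono ω b c (t - c)
    have h5 := count_initialWord_mono ω b (t + 1) (c + (M + 1) - (t + 1))
    rw [show c + (t - c) = t by omega] at h4
    rw [count_initialWord_succ, if_pos h3,
      show t + 1 + (c + (M + 1) - (t + 1)) = c + (M + 1) by omega] at h5
    omega
  -- Three windows of `M + 1` letters raise the count of `b` by at least three, so every residue
  -- modulo 3 is met.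
  have h1 := step c
  have h2 := step (c + (M + 1))
  have h3 := step (c + (M + 1) + (M + 1))
  rw [show c + (M + 1) + (M + 1) + (M + 1) = c + (3 * M + 3) by ring] at h3
  obtain ⟨d, hd1, hd2, hd3⟩ : ∃ d, (initialWord ω c).count b ≤ d ∧
      d < (initialWord ω c).count b + 3 ∧ d % 3 = i := by
    have := i.isLt
    refine ⟨(initialWord ω c).count b + (i + 3 - (initialWord ω c).count b % 3) % 3, ?_, ?_, ?_⟩ <;>
      omega
  obtain ⟨t, h4, h5, h6, h7⟩ := exists_count_eq (H := 3 * M + 3) hd1 (by omega)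
  refine ⟨t, ?_, h4, h5⟩
  subst h6
  simp only [cyclicRule, h7, hd3]

end ThresholdWords

theorem mainTheorem7 (n : ℕ) (hn : 5 ≤ n) :
    (∀ (L : ℕ) (V : Finset (List (Fin n))) (im : Fin n → Fin 3 → List (Fin n))
        (v v' : List (Fin n)),
      3 * n + 1 ≤ V.card →
      Function.Injective (Function.uncurry im) →
      (∀ a i, im a i ∈ V) →
      (∃ a i, v = im a i) →
      v' ∈ V → (∀ a i, v' ≠ im a i) →
      ThresholdWords.CyclicConditions n L V
        (ThresholdWords.imagesWith (fun a => Set.range (im a)) v v') →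
      (∀ w ∈ ThresholdWords.epsThreshold n (ThresholdWords.eps V L), ∀ S : Set ℕ,
        ThresholdWords.subst
            (ThresholdWords.replaceRule (ThresholdWords.cyclicRule im) v v' S) w ∈
          ThresholdWords.epsThreshold n (ThresholdWords.eps V L)) ∧
      (∀ ω : ℕ → Fin n,
        (∀ m, ThresholdWords.initialWord ω m ∈
          ThresholdWords.epsThreshold n (ThresholdWords.eps V L)) →
        ThresholdWords.replacementTree (ThresholdWords.cyclicRule im) v v' ω ⊆
          ThresholdWords.epsThreshold n (ThresholdWords.eps V L) ∧
        ThresholdWords.UniformlyGrowing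
          (ThresholdWords.replacementTree (ThresholdWords.cyclicRule im) v v' ω)
          ((3 * n - 3) * L) ((3 * n + 3) * L))) ∧
    (∀ (k L : ℕ) (V : Finset (List (Fin n))) (f : Fin (n + k) → List (Fin n))
        (v v' : List (Fin n)),
      1 ≤ k →
      n + k + 1 ≤ V.card →
      Function.Injective f →
      (∀ a, f a ∈ V) →
      (∃ a, v = f a) →
      v' ∈ V → (∀ a, v' ≠ f a) →
      ThresholdWords.MorphismConditions n L V →
      ThresholdWords.OverlapCondition n L 0 V
        (ThresholdWords.imagesWith (fun a => {f a}) v v') →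
      (∀ w ∈ ThresholdWords.threshold (n + k), ∀ S : Set ℕ,
        ThresholdWords.subst
            (ThresholdWords.replaceRule (ThresholdWords.morphismRule f) v v' S) w ∈
          ThresholdWords.threshold n) ∧
      (∀ ω : ℕ → Fin (n + k),
        (∀ m, ThresholdWords.initialWord ω m ∈ ThresholdWords.threshold (n + k)) →
        ThresholdWords.replacementTree (ThresholdWords.morphismRule f) v v' ω ⊆
          ThresholdWords.threshold n ∧
        ThresholdWords.UniformlyGrowing
          (ThresholdWords.replacementTree (ThresholdWords.morphismRule f) v v' ω)
          ((n + k - 1) * L) ((n + k + 1) * L))) := by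
  have : NeZero n := ⟨by omega⟩
  refine ⟨?_, ?_⟩
  · intro L V im v v' hcard hinj him hv hv'V hv' h
    have hV : 1 < V.card := by omega
    have hmem : ∀ (a : ℕ → Fin n) (m : ℕ), ThresholdWords.initialWord a m ∈
        ThresholdWords.epsThreshold n (ThresholdWords.eps V L) → ∀ S : Set ℕ,
        ThresholdWords.subst (ThresholdWords.replaceRule (ThresholdWords.cyclicRule im) v v' S)
          (ThresholdWords.initialWord a m) ∈
        ThresholdWords.epsThreshold n (ThresholdWords.eps V L) := fun a m ha S =>
      ThresholdWords.subst_replaceRule_cyclic_mem hn hV hinj him hv'V hv' h ha S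
    obtain ⟨b, i, rfl⟩ := hv
    refine ⟨fun w hw S => ?_, fun ω hω => ⟨?_, ?_⟩⟩
    · obtain ⟨a, ha⟩ := ThresholdWords.exists_eq_initialWord w
      rw [ha] at hw ⊢
      exact hmem a _ hw S
    · rintro x ⟨S, m, hx⟩
      exact ThresholdWords.epsThreshold_of_infix hx.isInfix (hmem ω m (hω m) S)
    · refine ThresholdWords.uniformlyGrowing_replacementTree
        (fun u a => h.length_eq _ (him _ _)) (h.length_eq _ (him b i)) (h.length_eq _ hv'V)
        (hv' b i).symm (fun c c' h1 h2 hcc' => ?_) (fun c => ?_)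
      · obtain ⟨h3, h4⟩ := ThresholdWords.cyclicRule_eq hinj (h1.trans h2.symm)
        have := ThresholdWords.three_mul_le_of_count_mod (a := ω) (m := c' + 1) (g := n - 1)
          (fun i j hij hj he => ThresholdWords.le_of_letter_eq (by omega) (hω (c' + 1)).2
            hij hj he) (c := c) (k := c' - c) (by omega) (by omega)
          (by rw [h3]; congr 1; omega)
          (by rw [show c + (c' - c) = c' by omega, h4, h3])
        omega
      · exact ThresholdWords.exists_cyclicRule_eq (by omega) (fun m => (hω m).2) im b i c
  · intro k L V f v v' hk hcard hinj hf hv hv'V hv' h hO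
    have hV : 1 < V.card := by omega
    have hmem : ∀ (a : ℕ → Fin (n + k)) (m : ℕ), ThresholdWords.initialWord a m ∈
        ThresholdWords.threshold (n + k) → ∀ S : Set ℕ,
        ThresholdWords.subst (ThresholdWords.replaceRule (ThresholdWords.morphismRule f) v v' S)
          (ThresholdWords.initialWord a m) ∈ ThresholdWords.threshold n := fun a m ha S =>
      ThresholdWords.subst_replaceRule_morphism_mem hn hk hV hinj hf hv'V hv' h hO ha S
    obtain ⟨b, rfl⟩ := hv
    have : NeZero (n + k) := ⟨by omega⟩
    refine ⟨fun w hw S => ?_, fun ω hω => ⟨?_, ?_⟩⟩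
    · obtain ⟨a, ha⟩ := ThresholdWords.exists_eq_initialWord w
      rw [ha] at hw ⊢
      exact hmem a _ hw S
    · rintro x ⟨S, m, hx⟩
      rw [← ThresholdWords.epsThreshold_zero]
      exact ThresholdWords.epsThreshold_of_infix hx.isInfix (by
        rw [ThresholdWords.epsThreshold_zero]; exact hmem ω m (hω m) S)
    · refine ThresholdWords.uniformlyGrowing_replacementTree
        (fun u a => h.length_eq _ (hf _)) (h.length_eq _ (hf b)) (h.length_eq _ hv'V)
        (hv' b).symm (fun c c' h1 h2 hcc' => ?_) (fun c => ?_)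
      · exact ThresholdWords.le_of_letter_eq (by omega) (hω (c' + 1)) hcc' (by omega)
          (hinj (h1.trans h2.symm))
      · obtain ⟨t, h1, h2, h3⟩ := ThresholdWords.exists_letter_window (by omega)
          (hω (c + (n + k + 1))) le_rfl b
        exact ⟨t, congrArg f h3, h1, h2⟩
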